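/- Let $F=\mathrm{GF}(q)$ be a finite field, let $K=\mathrm{GF}(q^b)$ be an extension of degree $b\ge 1$, and let $\mathrm{Irr}(q,b)$ be the set of monic irreducible polynomials of degree $b$ over $F$, with $N=|\mathrm{Irr}(q,b)|$. For $X\in \mathrm{M}(c,q^b)$ let $X_F$ be the $F$-linear map $v\mapsto vX$ on the $bc$-dimensional $F$-space $K^c$. For an irreducible $f$ over $F$, call $X_F$ $f$-primary cyclic if its $f$-primary component (the subspace of vectors annihilated by some power of $f(X_F)$) is nonzero and the restriction of $X_F$ to it has minimal polynomial equal to its characteristic polynomial. For nonempty $I\subseteq \mathrm{Irr}(q,b)$ let $\mathrm{pcb}_I(I,c,q^b)$ be the set of $X\in \mathrm{M}(c,q^b)$ such that $X_F$ is $f$-primary cyclic for all $f\in I$, let $\mathrm{pcb}(c,q^b)$ be the set of $X\in \mathrm{M}(c,q^b)$ such that $X_F$ is $f$-primary cyclic for some $f\in\mathrm{Irr}(q,b)$, and put \[\mathrm{PCBI}(I,u,q^b)=\sum_{c=1}^\infty\frac{|\mathrm{pcb}_I(I,c,q^b)|}{|\mathrm{GL}(c,q^b)|}u^c,\qquad \mathrm{PCB}(u,q^b)=\sum_{c=1}^\infty\frac{|\mathrm{pcb}(c,q^b)|}{|\mathrm{GL}(c,q^b)|}u^c.\]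 Let \[P(u,q^b)=1+\sum_{n=1}^\infty \frac{u^n}{\prod_{i=1}^n(1-q^{-bi})},\quad S(u,q^b)=\sum_{n=1}^\infty\frac{u^n}{q^{bn}(1-q^{-b})},\quad H(u,q^b)=b\,P(u,q^b)^{-b}(1-u)^{-b}S(u,q^b).\] Then for every $u\in\mathbb{C}$ with $|u|<1$ all four series converge absolutely, $P(u,q^b)\neq 0$, \[\mathrm{PCBI}(I,u,q^b)=P(u,q^b)\,H(u,q^b)^{|I|}\quad\text{for every nonempty } I\subseteq\mathrm{Irr}(q,b),\] and \[\mathrm{PCB}(u,q^b)=P(u,q^b)\left(1-(1-H(u,q^b))^N\right).\] -/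

import Mathlib

namespace PrimaryCyclic

noncomputable section

/-- The `f`-primary component of an endomorphism `T`: all vectors killed by a power of `f(T)`.
It is the zero subspace when the irreducible `f` does not divide the characteristic polynomial. -/
def primaryComponent {F V : Type*} [Field F] [AddCommGroup V] [Module F V]
    (T : Module.End F V) (f : Polynomial F) : Submodule F V where
  carrier := {v | ∃ k : ℕ, Polynomial.aeval T (f ^ k) v = 0}
  zero_mem' := ⟨0, by simp⟩
  add_mem' := by
    rintro v w ⟨k, hk⟩ ⟨l, hl⟩
    refine ⟨k + l, ?_⟩
    rw [map_add, pow_add]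
    nth_rewrite 1 [mul_comm]
    simp [Module.End.mul_apply, -map_pow, hk, hl]
  smul_mem' := by
    rintro a v ⟨k, hk⟩
    exact ⟨k, by rw [map_smul, hk, smul_zero]⟩

theorem primaryComponent_invariant {F V : Type*} [Field F] [AddCommGroup V] [Module F V]
    (T : Module.End F V) (f : Polynomial F) :
    ∀ v ∈ primaryComponent T f, T v ∈ primaryComponent T f := by
  rintro v ⟨k, hk⟩
  refine ⟨k, ?_⟩
  have h : Polynomial.aeval T (f ^ k) * T = T * Polynomial.aeval T (f ^ k) := by
    have := congrArg (Polynomial.aeval T) (mul_comm (f ^ k) Polynomial.X)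
    simpa only [map_mul, Polynomial.aeval_X] using this
  have h2 := congrArg (fun S : Module.End F V => S v) h
  simp only [Module.End.mul_apply] at h2
  rw [h2, hk, map_zero]

/-- `T` is cyclic: its minimal and characteristic polynomials agree. -/
def IsCyclic {F V : Type*} [Field F] [AddCommGroup V] [Module F V] [FiniteDimensional F V]
    (T : Module.End F V) : Prop :=
  minpoly F T = LinearMap.charpoly T

/-- `T` is `f`-primary cyclic: its `f`-primary component is nontrivial and the restriction of `T`
to it is cyclic. -/
def IsPrimaryCyclic {F V : Type*} [Field F] [AddCommGroup V] [Module F V]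
    [FiniteDimensional F V] (T : Module.End F V) (f : Polynomial F) : Prop :=
  primaryComponent T f ≠ ⊥ ∧
    IsCyclic (LinearMap.restrict T (primaryComponent_invariant T f))

/-- The monic irreducible polynomials of degree `d` over `F`. -/
def Irr (F : Type*) [Field F] (d : ℕ) : Set (Polynomial F) :=
  {f | f.Monic ∧ Irreducible f ∧ f.natDegree = d}

/-- `X_F`: the matrix `X` over `K`, acting on the row space `K^c` by `v ↦ v X`, regarded as an
endomorphism of the `F`-vector space `K^c` (of dimension `c * [K : F]`). -/
def overF (F : Type*) {K : Type*} [Field F] [Field K] [Algebra F K] {c : ℕ}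
    (X : Matrix (Fin c) (Fin c) K) : Module.End F (Fin c → K) :=
  X.vecMulLinear.restrictScalars F

/-- The `c × c` matrices `X` over `K` such that `X_F` is `f`-primary cyclic for all `f ∈ I`. -/
def pcbI (F K : Type*) [Field F] [Field K] [Algebra F K] [FiniteDimensional F K]
    (I : Finset (Polynomial F)) (c : ℕ) : Set (Matrix (Fin c) (Fin c) K) :=
  {X | ∀ f ∈ I, IsPrimaryCyclic (overF F X) f}

/-- The `c × c` matrices `X` over `K` such that `X_F` is `f`-primary cyclic for some monic
irreducible `f` over `F` of degree `b = [K : F]`. -/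
def pcb (F K : Type*) [Field F] [Field K] [Algebra F K] [FiniteDimensional F K]
    (c : ℕ) : Set (Matrix (Fin c) (Fin c) K) :=
  {X | ∃ f ∈ Irr F (Module.finrank F K), IsPrimaryCyclic (overF F X) f}

/-- The term `|A| / |GL(c, K)| u^c` of the generating function of a family of sets of matrices. -/
def genTerm {K : Type*} [Field K] (A : (c : ℕ) → Set (Matrix (Fin c) (Fin c) K)) (u : ℂ)
    (c : ℕ) : ℂ :=
  ((A c).ncard : ℂ) / (Nat.card (Matrix.GeneralLinearGroup (Fin c) K) : ℂ) * u ^ c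

/-- The generating function `∑_{c ≥ 1} |pcbI(I, c)| / |GL(c, K)| u^c`. -/
def PCBI (F K : Type*) [Field F] [Field K] [Algebra F K] [FiniteDimensional F K]
    (I : Finset (Polynomial F)) (u : ℂ) : ℂ :=
  ∑' c : ℕ, genTerm (pcbI F K I) u (c + 1)

/-- The generating function `∑_{c ≥ 1} |pcb(c)| / |GL(c, K)| u^c`. -/
def PCB (F K : Type*) [Field F] [Field K] [Algebra F K] [FiniteDimensional F K] (u : ℂ) : ℂ :=
  ∑' c : ℕ, genTerm (pcb F K) u (c + 1)

/-- `ω_n(u, Q) = ∏_{i=1}^n (1 - u Q^{-i})`. -/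
def omegaN (n : ℕ) (u : ℂ) (Q : ℕ) : ℂ := ∏ i ∈ Finset.Icc 1 n, (1 - u * ((Q : ℂ) ^ i)⁻¹)

/-- The `n`-th term of `P(u, Q)`. -/
def PTerm (u : ℂ) (Q n : ℕ) : ℂ := u ^ n / omegaN n 1 Q

/-- `P(u, Q) = 1 + ∑_{n ≥ 1} u^n / ω_n(1, Q)`. -/
def P (u : ℂ) (Q : ℕ) : ℂ := 1 + ∑' n : ℕ, PTerm u Q (n + 1)

/-- The `n`-th term of `S(u, Q)`. -/
def STerm (u : ℂ) (Q n : ℕ) : ℂ := u ^ n / ((Q : ℂ) ^ n * (1 - (Q : ℂ)⁻¹))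

/-- `S(u, Q) = ∑_{n ≥ 1} u^n / (Q^n (1 - Q^{-1}))`. -/
def S (u : ℂ) (Q : ℕ) : ℂ := ∑' n : ℕ, STerm u Q (n + 1)

/-- `H(u, q^b) = b P(u, q^b)^{-b} (1 - u)^{-b} S(u, q^b)`. -/
def H (u : ℂ) (q b : ℕ) : ℂ :=
  (b : ℂ) * P u (q ^ b) ^ (-(b : ℤ)) * (1 - u) ^ (-(b : ℤ)) * S u (q ^ b)

end

end PrimaryCyclic

/-! Let `Q = q^b = |K|`. An irreducible `f` of degree `b = [K : F]` splits over `K` into `b`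
distinct linear factors. Moreover `X_F` is `f`-primary cyclic exactly when `ker f(X_F)` has
`F`-dimension `b`, that is, when `ker f(X)` has `K`-dimension 1 (`isPrimaryCyclic_iff`). Since `ker
f(X)` is the direct sum of the eigenspaces of `X` at the roots of `f`, the condition says that the
geometric multiplicities at these `b` roots sum to 1 (`isPrimaryCyclic_overF_iff`).

Distinct eigenvalues behave independently. The Fitting decomposition at `a` writes an endomorphism
as `Y ⊕ Z`, where `Y - a` is nilpotent and `a` is not an eigenvalue of `Z`. The decompositions of a
fixed endomorphism form a torsor under `GL(U) × GL(W)`, so generating functions weighted by `1 /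
|GL|` factor (`genFun_and_eq_mul`). All endomorphisms give `P` and invertible ones give `1 / (1 -
u)`, so an unrestricted eigenvalue contributes `(1 - u) P`. An absent eigenvalue contributes 1, and
one with a one-dimensional eigenspace contributes `S`, by counting cyclic vectors
(`card_regular_nilpotent_mul`).

Requiring multiplicity sum 1 over `b` eigenvalues thus replaces `((1 - u) P)^b` by `b S`, which
multiplies the generating function by `H` (`genFun_sum_eq_one`); the opposite condition multiplies
it by `1 - H`. Distinct `f` have disjoint root sets, so these factors multiply, and `PCB` follows by
complementation. Division is legitimate because `P` has no zeros in the unit disc (`P_ne_zero`). -/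

namespace PrimaryCyclic

open Module Polynomial Filter Topology

noncomputable section

/-! ### Fitting decomposition at an eigenvalue. -/

section Splitting

variable {K U V W : Type*} [Field K] [AddCommGroup U] [Module K U]
  [AddCommGroup V] [Module K V] [AddCommGroup W] [Module K W]

/-- The geometric multiplicity of `a` as an eigenvalue of `T`. -/
def eigDim {K V : Type*} [Field K] [AddCommGroup V] [Module K V] (T : End K V) (a : K) : ℕ :=
  finrank K (T.eigenspace a)

theorem eigDim_eq_zero_iff [FiniteDimensional K V] {T : End K V} {a : K} :
    eigDim T a = 0 ↔ ∀ x, T x = a • x → x = 0 := by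
  rw [eigDim, Submodule.finrank_eq_zero, Submodule.eq_bot_iff]
  simp only [End.mem_eigenspace_iff]

theorem eigDim_conj (e : V ≃ₗ[K] W) (T : End K V) : eigDim (e.conj T) = eigDim T := by
  ext a
  refine (LinearEquiv.finrank_eq (e.ofSubmodules _ _ ?_)).symm
  ext x
  constructor
  · rintro ⟨y, hy, rfl⟩
    have := End.mem_eigenspace_iff.1 hy
    simp [LinearEquiv.conj_apply, this]
  · intro hx
    refine ⟨e.symm x, ?_, by simp⟩
    have := End.mem_eigenspace_iff.1 hx
    simp only [LinearEquiv.conj_apply, LinearMap.comp_apply, LinearEquiv.coe_coe] at this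
    refine End.mem_eigenspace_iff.2 (e.injective ?_)
    simpa using this

theorem eigDim_prodMap [FiniteDimensional K U] [FiniteDimensional K W] (Y : End K U) (Z : End K W) (a : K) :
    eigDim (Y.prodMap Z : End K (U × W)) a = eigDim Y a + eigDim Z a := by
  unfold eigDim
  rw [← finrank_prod]
  refine LinearEquiv.finrank_eq ?_
  have h : (End.eigenspace (Y.prodMap Z : End K (U × W)) a) =
      (Y.eigenspace a).prod (Z.eigenspace a) := by
    ext ⟨x, y⟩
    simp
  rw [h]
  exact
    { toFun := fun x => (⟨x.1.1, x.2.1⟩, ⟨x.1.2, x.2.2⟩)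
      invFun := fun x => ⟨(x.1, x.2), x.1.2, x.2.2⟩
      map_add' := fun _ _ => rfl
      map_smul' := fun _ _ => rfl
      left_inv := fun _ => rfl
      right_inv := fun _ => rfl }

theorem eigDim_eq_zero_of_isNilpotent_sub [FiniteDimensional K U] {Y : End K U} {a c : K}
    (hY : IsNilpotent (Y - algebraMap K (End K U) a)) (hc : c ≠ a) : eigDim Y c = 0 := by
  rw [eigDim_eq_zero_iff]
  intro x hx
  by_contra h
  have h1 : (Y - algebraMap K (End K U) a).HasEigenvalue (c - a) :=
    End.hasEigenvalue_of_hasEigenvector (x := x)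
      ⟨by simp [hx, sub_smul], h⟩
  exact sub_ne_zero.2 hc (h1.isNilpotent_of_isNilpotent hY).eq_zero

theorem isNilpotent_conj_sub (e : V ≃ₗ[K] W) {Y : End K V} {a : K}
    (hY : IsNilpotent (Y - algebraMap K (End K V) a)) :
    IsNilpotent (e.conj Y - algebraMap K (End K W) a) := by
  have h1 := hY.map (LinearEquiv.conjRingEquiv e)
  have h2 : LinearEquiv.conjRingEquiv e (algebraMap K _ a) = algebraMap K (End K W) a := by
    ext x
    simp
  rwa [map_sub, h2] at h1

theorem rootMultiplicity_charpoly_eq_finrank [FiniteDimensional K U] {Y : End K U} {a : K}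
    (hY : IsNilpotent (Y - algebraMap K (End K U) a)) :
    Y.charpoly.rootMultiplicity a = finrank K U := by
  rw [← LinearMap.finrank_maxGenEigenspace_eq, ← finrank_top K U]
  suffices h : Y.maxGenEigenspace a = ⊤ by rw [h]
  rw [eq_top_iff]
  intro x _
  obtain ⟨n, hn⟩ := hY
  rw [End.mem_maxGenEigenspace]
  exact ⟨n, by rw [Algebra.algebraMap_eq_smul_one] at hn; rw [hn]; rfl⟩

theorem rootMultiplicity_charpoly_eq_zero [FiniteDimensional K W] {Z : End K W} {a : K} (hZ : eigDim Z a = 0) :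
    Z.charpoly.rootMultiplicity a = 0 := by
  rw [Polynomial.rootMultiplicity_eq_zero_iff]
  intro h
  rw [← End.hasEigenvalue_iff_isRoot_charpoly, End.hasEigenvalue_iff] at h
  exact absurd (Submodule.finrank_eq_zero.1 hZ) h

theorem rootMultiplicity_charpoly_conj_prodMap [FiniteDimensional K U] [FiniteDimensional K V]
    [FiniteDimensional K W] (e : (U × W) ≃ₗ[K] V) {Y : End K U} {Z : End K W}
    {a : K} (hY : IsNilpotent (Y - algebraMap K (End K U) a)) (hZ : eigDim Z a = 0) :
    (e.conj (Y.prodMap Z)).charpoly.rootMultiplicity a = finrank K U := by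
  rw [LinearEquiv.charpoly_conj, LinearMap.charpoly_prodMap, Polynomial.rootMultiplicity_mul
    (mul_ne_zero (LinearMap.charpoly_monic _).ne_zero (LinearMap.charpoly_monic _).ne_zero),
    rootMultiplicity_charpoly_eq_finrank hY, rootMultiplicity_charpoly_eq_zero hZ, add_zero]

theorem exists_conj_prodMap_of_isCompl {T : End K V} {A B : Submodule K V} (h : IsCompl A B)
    (hA : ∀ x ∈ A, T x ∈ A) (hB : ∀ x ∈ B, T x ∈ B) :
    (Submodule.prodEquivOfIsCompl A B h).conj ((T.restrict hA).prodMap (T.restrict hB)) = T := by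
  ext v
  obtain ⟨⟨x, y⟩, rfl⟩ := (Submodule.prodEquivOfIsCompl A B h).surjective v
  simp [LinearEquiv.conj_apply]

/-- Serves both to move a decomposition onto prescribed spaces and to let `GL(U) × GL(W)` act on
decompositions. -/
theorem conj_prodMap_congr {U' W' : Type*} [AddCommGroup U'] [Module K U'] [AddCommGroup W']
    [Module K W'] (e : (U × W) ≃ₗ[K] V) (e₁ : U' ≃ₗ[K] U) (e₂ : W' ≃ₗ[K] W) (Y : End K U)
    (Z : End K W) :
    ((e₁.prodCongr e₂).trans e).conj ((e₁.symm.conj Y).prodMap (e₂.symm.conj Z)) =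
      e.conj (Y.prodMap Z) := by
  ext v
  simp [LinearEquiv.conj_apply]

/-- Fitting decomposition at an eigenvalue, transported to prescribed spaces. -/
theorem exists_conj_prodMap [FiniteDimensional K U] [FiniteDimensional K V]
    [FiniteDimensional K W] (T : End K V) (a : K) (hUW : finrank K U + finrank K W = finrank K V)
    (hT : T.charpoly.rootMultiplicity a = finrank K U) :
    ∃ (e : (U × W) ≃ₗ[K] V) (Y : End K U) (Z : End K W),
      IsNilpotent (Y - algebraMap K (End K U) a) ∧ eigDim Z a = 0 ∧ e.conj (Y.prodMap Z) = T := by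
  set N : End K V := T - algebraMap K (End K V) a with hN
  have hTN : ∀ n, Commute T (N ^ n) := fun n =>
    ((Commute.refl T).sub_right (Algebra.commutes a T).symm).pow_right n
  have hTN' : ∀ n x, T ((N ^ n) x) = (N ^ n) (T x) := fun n x =>
    congrArg (fun S : End K V => S x) (hTN n)
  -- `n ≥ 1` ensures `ker N ≤ ker (N ^ n)`, so that the range part has no eigenvector for `a`.
  obtain ⟨n, h, hn⟩ := ((LinearMap.eventually_isCompl_ker_pow_range_pow N).and
    (Filter.eventually_ge_atTop 1)).exists
  have hA : ∀ x ∈ LinearMap.ker (N ^ n), T x ∈ LinearMap.ker (N ^ n) := by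
    intro x hx
    rw [LinearMap.mem_ker] at hx ⊢
    rw [← hTN', hx, map_zero]
  have hB : ∀ x ∈ LinearMap.range (N ^ n), T x ∈ LinearMap.range (N ^ n) := by
    rintro _ ⟨x, rfl⟩
    exact ⟨T x, (hTN' n x).symm⟩
  have h1 := exists_conj_prodMap_of_isCompl h hA hB
  have hY : IsNilpotent (T.restrict hA - algebraMap K (End K (LinearMap.ker (N ^ n))) a) := by
    refine ⟨n, ?_⟩
    ext x
    have : ∀ k, (((T.restrict hA - algebraMap K (End K (LinearMap.ker (N ^ n))) a) ^ k) x : V) =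
        (N ^ k) (x : V) := by
      intro k
      induction k with
      | zero => simp
      | succ k ih =>
        rw [pow_succ', pow_succ', End.mul_apply, End.mul_apply, ← ih]
        simp [hN]
    rw [this]
    exact x.2
  have hZ : eigDim (T.restrict hB) a = 0 := by
    rw [eigDim_eq_zero_iff]
    intro x hx
    have hx' : T x = a • (x : V) := congrArg Subtype.val hx
    have : (x : V) ∈ LinearMap.ker (N ^ n) := by
      obtain ⟨m, rfl⟩ := Nat.exists_eq_succ_of_ne_zero (Nat.one_le_iff_ne_zero.1 hn)
      have hNx : N x = 0 := by simp [hN, hx']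
      exact (congrArg (N ^ m) hNx).trans (map_zero _)
    exact Subtype.ext (Submodule.disjoint_def.1 h.disjoint _ this x.2)
  have hd : finrank K (LinearMap.ker (N ^ n)) = finrank K U := by
    rw [← hT, ← rootMultiplicity_charpoly_conj_prodMap (Submodule.prodEquivOfIsCompl _ _ h) hY hZ,
      h1]
  have hd' : finrank K (LinearMap.range (N ^ n)) = finrank K W := by
    have := LinearMap.finrank_range_add_finrank_ker (N ^ n)
    omega
  refine ⟨_, _, _, ?_, ?_, (conj_prodMap_congr (Submodule.prodEquivOfIsCompl _ _ h)
    (LinearEquiv.ofFinrankEq _ _ hd.symm) (LinearEquiv.ofFinrankEq _ _ hd'.symm)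
    (T.restrict hA) (T.restrict hB)).trans h1⟩
  · exact isNilpotent_conj_sub _ hY
  · rw [eigDim_conj, hZ]

/-- An intertwiner between a block with single eigenvalue `a` and a block without eigenvalue `a`
vanishes. -/
theorem intertwiner_eq_zero [FiniteDimensional K W] {Y : End K U} {Z : End K W} {a : K}
    (hY : IsNilpotent (Y - algebraMap K (End K U) a)) (hZ : eigDim Z a = 0) (g : U →ₗ[K] W)
    (h : ∀ x, g (Y x) = Z (g x)) : g = 0 := by
  obtain ⟨n, hn⟩ := hY
  -- If `g` kills `(Y - a) x`, then `g x` satisfies the eigenvector equation of `Z` at `a`, hence is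
  -- zero.
  have key : ∀ (n : ℕ) x, ((Y - algebraMap K (End K U) a) ^ n) x = 0 → g x = 0 := by
    intro n
    induction n with
    | zero => intro x hx; simp only [pow_zero, End.one_apply] at hx; rw [hx, map_zero]
    | succ n ih =>
      intro x hx
      rw [pow_succ, End.mul_apply] at hx
      have := ih _ hx
      refine eigDim_eq_zero_iff.1 hZ _ ?_
      rw [← h]
      simpa [sub_eq_zero] using this
  ext x
  exact key n x (by rw [hn]; rfl)

/-- `Z - a` is injective, hence surjective, so every `x` is `(Z - a)^n y`; then `g x = (Y - a)^n (g
y) = 0`. -/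
theorem intertwiner_eq_zero' [FiniteDimensional K W] {Y : End K U} {Z : End K W} {a : K}
    (hY : IsNilpotent (Y - algebraMap K (End K U) a)) (hZ : eigDim Z a = 0) (g : W →ₗ[K] U)
    (h : ∀ x, g (Z x) = Y (g x)) : g = 0 := by
  obtain ⟨n, hn⟩ := hY
  set M : End K W := Z - algebraMap K (End K W) a with hM
  have hinj : Function.Injective M := by
    rw [← LinearMap.ker_eq_bot, Submodule.eq_bot_iff]
    intro x hx
    refine eigDim_eq_zero_iff.1 hZ x ?_
    simpa [hM, sub_eq_zero] using hx
  have hsurj : Function.Surjective (M ^ n) := by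
    rw [End.coe_pow]
    exact (LinearMap.injective_iff_surjective.1 hinj).iterate n
  have key : ∀ (n : ℕ) x, g ((M ^ n) x) = ((Y - algebraMap K (End K U) a) ^ n) (g x) := by
    intro n
    induction n with
    | zero => simp
    | succ n ih =>
      intro x
      rw [pow_succ, pow_succ, End.mul_apply, End.mul_apply, ih]
      simp [hM, h]
  ext x
  obtain ⟨y, rfl⟩ := hsurj x
  rw [key, hn]
  rfl

end Splitting

/-! ### Counting endomorphisms through their decompositions. -/

section Counting

variable {K U V W : Type*} [Field K] [AddCommGroup U] [Module K U] [FiniteDimensional K U]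
  [AddCommGroup V] [Module K V]
  [AddCommGroup W] [Module K W] [FiniteDimensional K W]

/-- A condition on multiplicity functions that does not involve the multiplicities on `R`. -/
def IndepOf {K : Type*} (R : Set K) (Φ : (K → ℕ) → Prop) : Prop :=
  ∀ k l : K → ℕ, (∀ c, c ∉ R → k c = l c) → (Φ k ↔ Φ l)

/-- The choices of a decomposition `T = Y ⊕ Z` at `a` form a torsor under `GL(U) × GL(W)`. -/
theorem card_decompositions (e₀ : (U × W) ≃ₗ[K] V) {Y₀ : End K U} {Z₀ : End K W} {a : K}
    (hY₀ : IsNilpotent (Y₀ - algebraMap K (End K U) a)) (hZ₀ : eigDim Z₀ a = 0) :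
    Nat.card {t : ((U × W) ≃ₗ[K] V) × End K U × End K W //
      (IsNilpotent (t.2.1 - algebraMap K (End K U) a) ∧ eigDim t.2.2 a = 0) ∧
        t.1.conj (t.2.1.prodMap t.2.2) = e₀.conj (Y₀.prodMap Z₀)} =
      Nat.card (U ≃ₗ[K] U) * Nat.card (W ≃ₗ[K] W) := by
  rw [← Nat.card_prod]
  refine (Nat.card_congr (Equiv.ofBijective (fun p => ⟨((p.1.prodCongr p.2).trans e₀,
    p.1.symm.conj Y₀, p.2.symm.conj Z₀), ⟨isNilpotent_conj_sub _ hY₀,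
    (congrFun (eigDim_conj p.2.symm Z₀) a).trans hZ₀⟩, conj_prodMap_congr _ _ _ _ _⟩)
    ⟨?_, ?_⟩)).symm
  · rintro ⟨g, h⟩ ⟨g', h'⟩ hgh
    simp only [Subtype.mk.injEq, Prod.mk.injEq] at hgh
    have h1 : ∀ p, (g.prodCongr h) p = (g'.prodCongr h') p := fun p =>
      e₀.injective (by simpa using congrArg (fun e : (U × W) ≃ₗ[K] V => e p) hgh.1)
    ext x
    · simpa using congrArg Prod.fst (h1 (x, 0))
    · simpa using congrArg Prod.snd (h1 (0, x))
  · rintro ⟨⟨e, Y, Z⟩, ⟨hY, hZ⟩, h⟩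
    dsimp only at hY hZ h
    -- `m` compares the two decompositions. Its off-diagonal blocks intertwine operators without a
    -- common eigenvalue and vanish, so `m` is a pair `(g, g')`.
    set m : (U × W) ≃ₗ[K] (U × W) := e.trans e₀.symm with hm
    have hmYZ : ∀ x y, m (Y x, Z y) = (Y₀ (m (x, y)).1, Z₀ (m (x, y)).2) := by
      intro x y
      have := congrArg (fun S : End K V => e₀.symm (S (e (x, y)))) h
      simpa [LinearEquiv.conj_apply, hm] using this
    have h12 : ∀ y, (m (0, y)).1 = 0 := by
      have := intertwiner_eq_zero' hY₀ hZ
        (LinearMap.fst K U W ∘ₗ m.toLinearMap ∘ₗ LinearMap.inr K U W) (fun y => by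
          have := hmYZ 0 y
          rw [map_zero] at this
          simp [this])
      intro y
      exact congrArg (fun S : W →ₗ[K] U => S y) this
    have h21 : ∀ x, (m (x, 0)).2 = 0 := by
      have := intertwiner_eq_zero hY hZ₀
        (LinearMap.snd K U W ∘ₗ m.toLinearMap ∘ₗ LinearMap.inl K U W) (fun x => by
          have := hmYZ x 0
          rw [map_zero] at this
          simp [this])
      intro x
      exact congrArg (fun S : U →ₗ[K] W => S x) this
    let g : U ≃ₗ[K] U := LinearEquiv.ofInjectiveEndo
      (LinearMap.fst K U W ∘ₗ m.toLinearMap ∘ₗ LinearMap.inl K U W) <| by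
        rw [← LinearMap.ker_eq_bot, Submodule.eq_bot_iff]
        intro x hx
        have h0 : m (x, 0) = 0 := Prod.ext hx (h21 x)
        simpa using h0
    let g' : W ≃ₗ[K] W := LinearEquiv.ofInjectiveEndo
      (LinearMap.snd K U W ∘ₗ m.toLinearMap ∘ₗ LinearMap.inr K U W) <| by
        rw [← LinearMap.ker_eq_bot, Submodule.eq_bot_iff]
        intro x hx
        have h0 : m (0, x) = 0 := Prod.ext (h12 x) hx
        simpa using h0
    have hg : ∀ x, g x = (m (x, 0)).1 := fun _ => rfl
    have hg' : ∀ y, g' y = (m (0, y)).2 := fun _ => rfl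
    have hmg : ∀ x y, m (x, y) = (g x, g' y) := by
      intro x y
      have : m (x, y) = m (x, 0) + m (0, y) := by rw [← map_add]; simp
      rw [this]
      ext
      · simp [hg, h12]
      · simp [hg', h21]
    refine ⟨(g, g'), Subtype.ext (Prod.ext ?_ (Prod.ext ?_ ?_))⟩
    · ext p
      have := hmg p.1 p.2
      have h5 : e₀ (m p) = e p := by simp [hm]
      rw [← h5]
      simp [this]
    · ext x
      have := congrArg Prod.fst (hmYZ x 0)
      simp only [map_zero, hmg] at this
      simp [LinearEquiv.conj_apply, ← this]
    · ext y
      have := congrArg Prod.snd (hmYZ 0 y)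
      simp only [map_zero, hmg] at this
      simp [LinearEquiv.conj_apply, ← this]

theorem finite_linearEquiv [FiniteDimensional K V] [Finite K] : Finite (U ≃ₗ[K] V) := by
  have : Finite U := Module.finite_of_finite K
  have : Finite V := Module.finite_of_finite K
  exact DFunLike.finite _

/-- Counting endomorphisms through their decomposition at the eigenvalue `a`. -/
theorem card_rootMultiplicity_eq_mul [FiniteDimensional K V] [Finite K]
     (hUW : finrank K U + finrank K W = finrank K V)
    (a : K) {Φ : (K → ℕ) → Prop} (hΦ : IndepOf {a} Φ) (Ψ : ℕ → Prop) :
    Nat.card {T : End K V // (Φ (eigDim T) ∧ Ψ (eigDim T a)) ∧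
        T.charpoly.rootMultiplicity a = finrank K U} *
      (Nat.card (U ≃ₗ[K] U) * Nat.card (W ≃ₗ[K] W)) =
    Nat.card (V ≃ₗ[K] V) *
      (Nat.card {Y : End K U // IsNilpotent (Y - algebraMap K (End K U) a) ∧ Ψ (eigDim Y a)} *
        Nat.card {Z : End K W // Φ (eigDim Z) ∧ eigDim Z a = 0}) := by
  classical
  have : Finite (V ≃ₗ[K] V) := finite_linearEquiv
  have : Finite ((U × W) ≃ₗ[K] V) := finite_linearEquiv
  have : Finite (End K V) := Module.finite_of_finite K
  have : Finite (End K U) := Module.finite_of_finite K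
  have : Finite (End K W) := Module.finite_of_finite K
  have key : ∀ (e : (U × W) ≃ₗ[K] V) (Y : End K U) (Z : End K W),
      IsNilpotent (Y - algebraMap K (End K U) a) → eigDim Z a = 0 →
      ((Φ (eigDim (e.conj (Y.prodMap Z))) ↔ Φ (eigDim Z)) ∧
        eigDim (e.conj (Y.prodMap Z)) a = eigDim Y a) := by
    intro e Y Z hY hZ
    rw [eigDim_conj]
    refine ⟨hΦ _ _ fun c hc => ?_, ?_⟩
    · rw [eigDim_prodMap, eigDim_eq_zero_of_isNilpotent_sub hY hc, zero_add]
    · rw [eigDim_prodMap, hZ, add_zero]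
  have hV : Nat.card (V ≃ₗ[K] V) = Nat.card ((U × W) ≃ₗ[K] V) := by
    have e : V ≃ₗ[K] U × W := LinearEquiv.ofFinrankEq _ _ (by rw [finrank_prod, hUW])
    exact Nat.card_congr
      ⟨fun f => e.symm.trans f, fun f => e.trans f, fun f => by ext; simp, fun f => by ext1; simp⟩
  rw [hV, ← Nat.card_prod {Y : End K U // _}, ← Nat.card_prod ((U × W) ≃ₗ[K] V)]
  -- Double counting: `π` reassembles an endomorphism from its pieces, and all its fibres have size
  -- `|GL(U)| |GL(W)|`.
  let π : (((U × W) ≃ₗ[K] V) ×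
      {Y : End K U // IsNilpotent (Y - algebraMap K (End K U) a) ∧ Ψ (eigDim Y a)} ×
        {Z : End K W // Φ (eigDim Z) ∧ eigDim Z a = 0}) →
      {T : End K V // (Φ (eigDim T) ∧ Ψ (eigDim T a)) ∧
        T.charpoly.rootMultiplicity a = finrank K U} := fun t =>
    ⟨t.1.conj (t.2.1.1.prodMap t.2.2.1), ⟨(key _ _ _ t.2.1.2.1 t.2.2.2.2).1.2 t.2.2.2.1,
      (key t.1 _ _ t.2.1.2.1 t.2.2.2.2).2.symm ▸ t.2.1.2.2⟩,
      rootMultiplicity_charpoly_conj_prodMap t.1 t.2.1.2.1 t.2.2.2.2⟩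
  have := Fintype.ofFinite {T : End K V // (Φ (eigDim T) ∧ Ψ (eigDim T a)) ∧
        T.charpoly.rootMultiplicity a = finrank K U}
  rw [← Nat.card_congr (Equiv.sigmaFiberEquiv π), Nat.card_sigma,
    Finset.sum_congr rfl (g := fun _ => Nat.card (U ≃ₗ[K] U) * Nat.card (W ≃ₗ[K] W)),
    Finset.sum_const, Finset.card_univ, ← Nat.card_eq_fintype_card, smul_eq_mul]
  · rintro ⟨T, ⟨hT, hT'⟩, hTa⟩ -
    obtain ⟨e₀, Y₀, Z₀, hY₀, hZ₀, rfl⟩ := exists_conj_prodMap (U := U) (W := W) T a hUW hTa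
    rw [← card_decompositions e₀ hY₀ hZ₀]
    refine Nat.card_congr
      ⟨fun t => ⟨(t.1.1, t.1.2.1.1, t.1.2.2.1), ⟨t.1.2.1.2.1, t.1.2.2.2.2⟩,
          congrArg Subtype.val t.2⟩,
        fun t => ⟨(t.1.1, ⟨t.1.2.1, t.2.1.1, ?_⟩, ⟨t.1.2.2, ?_, t.2.1.2⟩),
          Subtype.ext t.2.2⟩, fun _ => rfl, fun _ => rfl⟩
    · have := (key t.1.1 _ _ t.2.1.1 t.2.1.2).2
      rw [← this, t.2.2]
      exact hT'
    · rw [← (key t.1.1 _ _ t.2.1.1 t.2.1.2).1, t.2.2]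
      exact hT

end Counting

/-! ### Dimension inequalities for kernels and ranges of powers. -/

section Kernels

variable {F V : Type*} [Field F] [AddCommGroup V] [Module F V] [FiniteDimensional F V]

theorem finrank_ker_mul_le (S R : End F V) :
    finrank F (LinearMap.ker (S * R)) ≤
      finrank F (LinearMap.ker S) + finrank F (LinearMap.ker R) := by
  set p := LinearMap.ker (S * R)
  have h := LinearMap.finrank_range_add_finrank_ker (R.domRestrict p)
  have h1 : finrank F (LinearMap.range (R.domRestrict p)) ≤ finrank F (LinearMap.ker S) := by
    refine Submodule.finrank_mono ?_
    rintro _ ⟨x, rfl⟩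
    exact x.2
  have h2 : finrank F (LinearMap.ker (R.domRestrict p)) ≤ finrank F (LinearMap.ker R) := by
    refine LinearMap.finrank_le_finrank_of_injective
      (f := (p.subtype.restrict (p := LinearMap.ker (R.domRestrict p)) (q := LinearMap.ker R)
        fun x hx => hx)) ?_
    intro x y hxy
    have h3 : ((x : p) : V) = (y : p) := 
      congrArg (Subtype.val (p := fun v => v ∈ LinearMap.ker R)) hxy
    exact Subtype.ext (Subtype.ext h3)
  omega

theorem finrank_ker_pow_le (S : End F V) (n : ℕ) :
    finrank F (LinearMap.ker (S ^ n)) ≤ n * finrank F (LinearMap.ker S) := by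
  induction n with
  | zero =>
    rw [pow_zero, show LinearMap.ker (1 : End F V) = ⊥ from LinearMap.ker_id]
    simp
  | succ n ih =>
    rw [pow_succ, add_mul, one_mul]
    exact (finrank_ker_mul_le _ _).trans (by omega)

/-- `S` maps `range (S ^ j)` onto `range (S ^ (j + 1))` and kills `q`; apply rank-nullity. -/
theorem finrank_range_pow_succ_add_le (S : End F V) {q : Submodule F V} {j : ℕ}
    (hq : q ≤ LinearMap.ker S) (hqj : q ≤ LinearMap.range (S ^ j)) :
    finrank F (LinearMap.range (S ^ (j + 1))) + finrank F q ≤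
      finrank F (LinearMap.range (S ^ j)) := by
  set p := LinearMap.range (S ^ j)
  have h := LinearMap.finrank_range_add_finrank_ker (S.domRestrict p)
  have h1 : finrank F (LinearMap.range (S ^ (j + 1))) ≤
      finrank F (LinearMap.range (S.domRestrict p)) := by
    refine Submodule.finrank_mono ?_
    rintro _ ⟨x, rfl⟩
    exact ⟨⟨(S ^ j) x, x, rfl⟩, by rw [pow_succ']; rfl⟩
  have h2 : finrank F q ≤ finrank F (LinearMap.ker (S.domRestrict p)) := by
    rw [← (Submodule.comapSubtypeEquivOfLe hqj).finrank_eq]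
    exact Submodule.finrank_mono fun x hx => hq hx
  omega

/-- If `S ^ (m + 1) = 0`, then every step of the chain of ranges drops the dimension by at least
the dimension of the last nonzero range. -/
theorem mul_finrank_range_pow_le (S : End F V) {m : ℕ} (hS : S ^ (m + 1) = 0) :
    m * finrank F (LinearMap.range (S ^ m)) ≤ finrank F (LinearMap.range S) := by
  have hker : LinearMap.range (S ^ m) ≤ LinearMap.ker S := by
    rintro _ ⟨x, rfl⟩
    rw [LinearMap.mem_ker, ← End.mul_apply, ← pow_succ', hS, LinearMap.zero_apply]
  have key : ∀ i, i ≤ m → (i + 1) * finrank F (LinearMap.range (S ^ m)) ≤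
      finrank F (LinearMap.range (S ^ (m - i))) := by
    intro i
    induction i with
    | zero => simp
    | succ i ih =>
      intro hi
      have h1 := ih (by omega)
      have h2 := finrank_range_pow_succ_add_le S (j := m - (i + 1)) hker <| by
        rintro _ ⟨x, rfl⟩
        refine ⟨(S ^ (i + 1)) x, ?_⟩
        rw [← End.mul_apply, ← pow_add]
        congr 2
        omega
      rw [show m - (i + 1) + 1 = m - i by omega] at h2
      rw [add_mul, one_mul]
      omega
  rcases m with _ | m
  · simp
  · have := key m (by omega)
    rwa [Nat.add_sub_cancel_left, pow_one] at this

end Kernels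

/-! ### Nilpotent endomorphisms with a single Jordan block. -/

section RegularNilpotent

variable {K V : Type*} [Field K] [AddCommGroup V] [Module K V]

theorem eigDim_zero_right (Y : End K V) : eigDim Y 0 = finrank K (LinearMap.ker Y) := by
  rw [eigDim, End.eigenspace_zero]

theorem pow_eq_zero_of_isNilpotent [FiniteDimensional K V] {Y : End K V} (hY : IsNilpotent Y)
    {n : ℕ} (hV : finrank K V = n) : Y ^ n = 0 := by
  have h := Y.aeval_self_charpoly
  rwa [hY.charpoly_eq_X_pow_finrank, hV, map_pow, Polynomial.aeval_X] at h

/-- If `Y ^ k = 0`, a one-dimensional kernel would force `dim V ≤ k`. If `Y ^ k ≠ 0`, the chain of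
ranges has at least `k` drops after `range Y`, so `Y` has rank at least `k`. -/
theorem eigDim_zero_eq_one_iff [FiniteDimensional K V] {Y : End K V} (hY : IsNilpotent Y) {k : ℕ}
    (hV : finrank K V = k + 1) : eigDim Y 0 = 1 ↔ Y ^ k ≠ 0 := by
  rw [eigDim_zero_right]
  have h0 := pow_eq_zero_of_isNilpotent hY hV
  have h1 := finrank_ker_pow_le Y k
  have h2 := mul_finrank_range_pow_le Y h0
  have h3 := LinearMap.finrank_range_add_finrank_ker Y
  have h4 := finrank_ker_pow_le Y (k + 1)
  rw [h0, LinearMap.ker_zero, finrank_top, hV] at h4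
  constructor
  · intro h hk
    rw [hk, LinearMap.ker_zero, finrank_top, hV, h] at h1
    omega
  · intro hk
    have h5 : 0 < finrank K (LinearMap.range (Y ^ k)) := by
      rw [Nat.pos_iff_ne_zero, Ne, Submodule.finrank_eq_zero, LinearMap.range_eq_bot]
      exact hk
    have h6 : k ≤ finrank K (LinearMap.range Y) := by nlinarith
    have h7 : finrank K (LinearMap.ker Y) ≠ 0 := fun h => by simp [h] at h4
    omega

theorem finrank_ker_pow_eq [FiniteDimensional K V] {Y : End K V} (hY : IsNilpotent Y) {k : ℕ}
    (hV : finrank K V = k + 1) (h1 : eigDim Y 0 = 1) : finrank K (LinearMap.ker (Y ^ k)) = k := by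
  have h0 := pow_eq_zero_of_isNilpotent hY hV
  rw [eigDim_zero_right] at h1
  have h2 := finrank_ker_pow_le Y k
  have h3 := LinearMap.finrank_range_add_finrank_ker (Y ^ k)
  have h4 : finrank K (LinearMap.range (Y ^ k)) ≤ finrank K (LinearMap.ker Y) := by
    refine Submodule.finrank_mono ?_
    rintro _ ⟨x, rfl⟩
    rw [LinearMap.mem_ker, ← End.mul_apply, ← pow_succ', h0, LinearMap.zero_apply]
  rw [h1] at h2 h4
  omega

theorem linearIndependent_pow_apply {Y : End K V} {k : ℕ} (h0 : Y ^ (k + 1) = 0) {v : V}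
    (hv : (Y ^ k) v ≠ 0) : LinearIndependent K fun i : Fin (k + 1) => (Y ^ (i : ℕ)) v := by
  rw [Fintype.linearIndependent_iff]
  intro c hc
  have key : ∀ n (hn : n < k + 1), c ⟨n, hn⟩ = 0 := by
    intro n
    induction n using Nat.strong_induction_on with
    | _ n ih =>
      intro hn
      -- This power kills the terms of index above `n`; those below vanish by induction, leaving `c
      -- n • (Y ^ k) v`.
      have h := congrArg (Y ^ (k - n)) hc
      rw [map_sum, map_zero, Finset.sum_eq_single (⟨n, hn⟩ : Fin (k + 1))] at h
      · rw [map_smul, ← End.mul_apply, ← pow_add, Nat.sub_add_cancel (by omega)] at h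
        exact (smul_eq_zero.1 h).resolve_right hv
      · intro j _ hj
        rw [map_smul, ← End.mul_apply, ← pow_add]
        rcases lt_or_gt_of_ne (fun h => hj (Fin.ext h) : (j : ℕ) ≠ n) with hlt | hgt
        · rw [ih j hlt j.2, zero_smul]
        · rw [show k - n + j = (k + 1) + (j - n - 1) by omega, pow_add, h0, zero_mul,
            LinearMap.zero_apply, smul_zero]
      · simp
  exact fun i => key i i.2

theorem exists_nilpotent_shift {k : ℕ} (hV : finrank K V = k + 1) {s : Fin (k + 1) → V}
    (hs : LinearIndependent K s) :
    ∃ Y : End K V, IsNilpotent Y ∧ ∀ i : Fin (k + 1), (Y ^ (i : ℕ)) (s 0) = s i := by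
  let b := basisOfLinearIndependentOfCardEqFinrank hs (by simp [hV])
  let Y : End K V := b.constr K fun i => if h : (i : ℕ) + 1 < k + 1 then s ⟨i + 1, h⟩ else 0
  have hY : ∀ i, Y (s i) = if h : (i : ℕ) + 1 < k + 1 then s ⟨i + 1, h⟩ else 0 := by
    intro i
    have : b i = s i := by simp [b]
    rw [← this, Basis.constr_basis]
  have hpow : ∀ n (hn : n < k + 1), (Y ^ n) (s 0) = s ⟨n, hn⟩ := by
    intro n
    induction n with
    | zero => intro _; rfl
    | succ n ih =>
      intro hn
      rw [pow_succ', End.mul_apply, ih (by omega), hY, dif_pos hn]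
  refine ⟨Y, ⟨k + 1, b.ext fun i => ?_⟩, fun i => hpow i i.2⟩
  have : b i = s i := by simp [b]
  rw [this, ← hpow i i.2, ← End.mul_apply, ← pow_add, add_comm, pow_add, End.mul_apply, pow_succ',
    End.mul_apply, hpow k (by omega), hY, dif_neg (by simp), map_zero, LinearMap.zero_apply]

/-- Both sides count pairs `(Y, v)` with `v` a cyclic vector of `Y`. Such a pair amounts to the
ordered basis `v, Y v, ..., Y ^ k v`, and the non-cyclic vectors form the hyperplane `ker (Y ^ k)`.
-/
theorem card_regular_nilpotent_mul [FiniteDimensional K V] [Finite K] {k : ℕ} (hV : finrank K V = k + 1) :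
    Nat.card {Y : End K V // IsNilpotent Y ∧ eigDim Y 0 = 1} *
      (Nat.card K ^ (k + 1) - Nat.card K ^ k) =
    Nat.card {s : Fin (k + 1) → V // LinearIndependent K s} := by
  classical
  have : Finite V := Module.finite_of_finite K
  have : Finite (End K V) := Module.finite_of_finite K
  have := Fintype.ofFinite {Y : End K V // IsNilpotent Y ∧ eigDim Y 0 = 1}
  have hzero : ∀ Y : End K V, IsNilpotent Y → Y ^ (k + 1) = 0 := fun Y hY =>
    pow_eq_zero_of_isNilpotent hY hV
  have hcard : ∀ Y : {Y : End K V // IsNilpotent Y ∧ eigDim Y 0 = 1},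
      Nat.card {v : V // (Y.1 ^ k) v ≠ 0} = Nat.card K ^ (k + 1) - Nat.card K ^ k := by
    rintro ⟨Y, hY, h1⟩
    have := Fintype.ofFinite V
    have h2 := Fintype.card_subtype_compl (fun v : V => (Y ^ k) v = 0)
    rw [← Nat.card_eq_fintype_card, ← Nat.card_eq_fintype_card, ← Nat.card_eq_fintype_card,
      Module.natCard_eq_pow_finrank (K := K) (V := V), hV] at h2
    have h3 : Nat.card {v : V // (Y ^ k) v = 0} = Nat.card K ^ k := by
      have := Module.natCard_eq_pow_finrank (K := K) (V := LinearMap.ker (Y ^ k))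
      rwa [finrank_ker_pow_eq hY hV h1] at this
    rw [h3] at h2
    exact h2
  let g : (Σ Y : {Y : End K V // IsNilpotent Y ∧ eigDim Y 0 = 1}, {v : V // (Y.1 ^ k) v ≠ 0}) →
      {s : Fin (k + 1) → V // LinearIndependent K s} := fun p =>
    ⟨fun i => (p.1.1 ^ (i : ℕ)) p.2.1, linearIndependent_pow_apply (hzero _ p.1.2.1) p.2.2⟩
  have hg : Function.Bijective g := by
    constructor
    · rintro ⟨⟨Y, hY, h1⟩, ⟨v, hv⟩⟩ ⟨⟨Y', hY', h1'⟩, ⟨v', hv'⟩⟩ h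
      have hi : ∀ n, n < k + 1 → (Y ^ n) v = (Y' ^ n) v' := fun n hn =>
        congrFun (congrArg Subtype.val h) ⟨n, hn⟩
      have hvv : v = v' := by simpa using hi 0 (by omega)
      subst hvv
      have hYY : Y = Y' := by
        let b := basisOfLinearIndependentOfCardEqFinrank
          (linearIndependent_pow_apply (hzero Y hY) hv) (by simp [hV])
        refine b.ext fun i => ?_
        have hb : b i = (Y ^ (i : ℕ)) v := by simp [b]
        rw [hb, ← End.mul_apply, ← pow_succ', hi i i.2, ← End.mul_apply, ← pow_succ']
        rcases Nat.lt_or_ge (i + 1 : ℕ) (k + 1) with hlt | hge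
        · exact hi _ hlt
        · rw [show (i : ℕ) + 1 = k + 1 by omega, hzero Y hY, hzero Y' hY']
      subst hYY
      rfl
    · rintro ⟨s, hs⟩
      obtain ⟨Y, hY, hYs⟩ := exists_nilpotent_shift hV hs
      have hk : (Y ^ k) (s 0) ≠ 0 := by
        have := hYs (Fin.last k)
        rw [Fin.val_last] at this
        rw [this]
        exact hs.ne_zero _
      have h1 : eigDim Y 0 = 1 := (eigDim_zero_eq_one_iff hY hV).2 fun h => hk (by rw [h]; rfl)
      exact ⟨⟨⟨Y, hY, h1⟩, ⟨s 0, hk⟩⟩, Subtype.ext (funext hYs)⟩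
  rw [← Nat.card_congr (Equiv.ofBijective g hg), Nat.card_sigma, Finset.sum_congr rfl
    fun Y _ => hcard Y, Finset.sum_const, Finset.card_univ, smul_eq_mul, Nat.card_eq_fintype_card]

end RegularNilpotent

/-! ### Primary cyclicity as a condition on `ker f(T)`. -/

section PrimaryComponent

variable {F V : Type*} [Field F] [AddCommGroup V] [Module F V]

theorem coe_aeval_restrict {T : End F V} {N : Submodule F V} (hN : ∀ v ∈ N, T v ∈ N) (p : F[X])
    (x : N) : ((aeval (T.restrict hN) p) x : V) = (aeval T p) (x : V) := by
  induction p using Polynomial.induction_on' with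
  | add p r hp hr => simp [hp, hr]
  | monomial n a =>
    have h : ∀ n, (((T.restrict hN) ^ n) x : V) = (T ^ n) (x : V) := by
      intro n
      induction n with
      | zero => simp
      | succ n ih =>
        rw [pow_succ', pow_succ', End.mul_apply, End.mul_apply, ← ih]
        rfl
    rw [aeval_monomial, aeval_monomial]
    simp [h]

variable [FiniteDimensional F V]

theorem natDegree_minpoly_le_finrank (T : End F V) :
    (minpoly F T).natDegree ≤ finrank F V := by
  rw [← T.charpoly_natDegree]
  exact natDegree_le_of_dvd T.minpoly_dvd_charpoly T.charpoly_monic.ne_zero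

theorem natDegree_le_finrank_of_le_ker {T : End F V} {f : F[X]} (hf : Irreducible f)
    {N : Submodule F V} (hN : ∀ v ∈ N, T v ∈ N) (hbot : N ≠ ⊥)
    (hker : N ≤ LinearMap.ker (aeval T f)) : f.natDegree ≤ finrank F N := by
  have : Nontrivial N := (Submodule.nontrivial_iff_ne_bot).2 hbot
  have h0 : aeval (T.restrict hN) f = 0 := by
    ext x
    rw [coe_aeval_restrict]
    exact hker x.2
  have h1 : Associated (minpoly F (T.restrict hN)) f :=
    ((hf.dvd_iff.1 (minpoly.dvd F _ h0)).resolve_left (minpoly.not_isUnit _ _)).symm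
  rw [← natDegree_eq_of_degree_eq (degree_eq_degree_of_associated h1)]
  exact natDegree_minpoly_le_finrank _

/-- The minimal polynomial is `f ^ m`. In the cyclic case `dim V = m deg f`, and the last nonzero
range has dimension at least `deg f`, so the chain of ranges bounds the rank of `f(T)` below by `(m
- 1) deg f`. Conversely `dim V = dim ker f(T)^m ≤ m deg f`, so the characteristic polynomial is no
larger than the minimal one. -/
theorem isCyclic_iff_of_pow_eq_zero {T : End F V} {f : F[X]} (hf : Irreducible f)
    (hm : f.Monic) {M : ℕ} (hM : aeval T (f ^ M) = 0) :
    (Nontrivial V ∧ IsCyclic T) ↔ finrank F (LinearMap.ker (aeval T f)) = f.natDegree := by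
  have hint : IsIntegral F T := Algebra.IsIntegral.isIntegral T
  obtain ⟨m, -, hass⟩ := (dvd_prime_pow hf.prime M).1 (minpoly.dvd F T hM)
  have hmin : minpoly F T = f ^ m := eq_of_monic_of_associated (minpoly.monic hint) (hm.pow m) hass
  have hSm : (aeval T f) ^ m = 0 := by
    rw [← map_pow, ← hmin, minpoly.aeval]
  have hd : 0 < f.natDegree := hf.natDegree_pos
  constructor
  · rintro ⟨hV, hc⟩
    have hfin : finrank F V = m * f.natDegree := by
      rw [← T.charpoly_natDegree, ← hc, hmin, natDegree_pow]
    obtain _ | m := m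
    · have := finrank_pos (R := F) (M := V)
      omega
    -- The case split has shifted `m`: the minimal polynomial is now `f ^ (m + 1)`.
    have hne : (aeval T f) ^ m ≠ 0 := by
      rw [← map_pow]
      intro h
      have := natDegree_le_of_dvd (minpoly.dvd F T h) (hm.pow m).ne_zero
      rw [hmin, natDegree_pow, natDegree_pow] at this
      nlinarith
    have hcomm : ∀ x n, T (((aeval T f) ^ n) x) = ((aeval T f) ^ n) (T x) := by
      intro x n
      have h : Commute T (aeval T f) := by
        have := (Commute.all X f).map (aeval T)
        rwa [aeval_X] at this
      exact congrArg (fun S : End F V => S x) (h.pow_right n)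
    have hrk : LinearMap.range ((aeval T f) ^ m) ≤ LinearMap.ker (aeval T f) := by
      rintro _ ⟨x, rfl⟩
      rw [LinearMap.mem_ker, ← End.mul_apply, ← pow_succ', hSm, LinearMap.zero_apply]
    have h1 : f.natDegree ≤ finrank F (LinearMap.range ((aeval T f) ^ m)) := by
      refine natDegree_le_finrank_of_le_ker (T := T) hf ?_ ?_ hrk
      · rintro _ ⟨x, rfl⟩
        exact ⟨T x, (hcomm x m).symm⟩
      · rwa [Ne, LinearMap.range_eq_bot]
    have h2 := mul_finrank_range_pow_le _ hSm
    have h3 := LinearMap.finrank_range_add_finrank_ker (aeval T f)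
    have h4 := Submodule.finrank_mono hrk
    have h5 : m * f.natDegree ≤ m * finrank F (LinearMap.range ((aeval T f) ^ m)) :=
      Nat.mul_le_mul_left _ h1
    rw [hfin, add_mul, one_mul] at h3
    omega
  · intro h
    have hV : Nontrivial V := by
      by_contra hV
      rw [not_nontrivial_iff_subsingleton] at hV
      rw [finrank_zero_of_subsingleton] at h
      omega
    refine ⟨hV, (eq_of_monic_of_dvd_of_natDegree_le (minpoly.monic hint) T.charpoly_monic
      T.minpoly_dvd_charpoly ?_).symm⟩
    have h1 := finrank_ker_pow_le (aeval T f) m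
    rw [hSm, LinearMap.ker_zero, finrank_top, h] at h1
    rwa [T.charpoly_natDegree, hmin, natDegree_pow]

theorem exists_pow_eq_zero_primaryComponent (T : End F V) (f : F[X]) :
    ∃ M, aeval (T.restrict (primaryComponent_invariant T f)) (f ^ M) = 0 := by
  have h := (LinearMap.eventually_iSup_ker_pow_eq (aeval T f)).exists
  obtain ⟨M, hM⟩ := h
  refine ⟨M, ?_⟩
  ext x
  rw [coe_aeval_restrict]
  obtain ⟨k, hk⟩ := x.2
  rw [map_pow] at hk ⊢
  have : (x : V) ∈ ⨆ m, LinearMap.ker ((aeval T f) ^ m) := Submodule.mem_iSup_of_mem k hk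
  rw [hM] at this
  exact this

/-- `ker f(T)` already lies in the primary component, so the cyclicity criterion there can be read
off on all of `V`. -/
theorem isPrimaryCyclic_iff {T : End F V} {f : F[X]} (hf : Irreducible f) (hm : f.Monic) :
    IsPrimaryCyclic T f ↔ finrank F (LinearMap.ker (aeval T f)) = f.natDegree := by
  obtain ⟨M, hM⟩ := exists_pow_eq_zero_primaryComponent T f
  have h := isCyclic_iff_of_pow_eq_zero hf hm hM
  rw [IsPrimaryCyclic, ← Submodule.nontrivial_iff_ne_bot, h]
  have hmap : (LinearMap.ker (aeval (T.restrict (primaryComponent_invariant T f)) f)).map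
      (primaryComponent T f).subtype = LinearMap.ker (aeval T f) := by
    ext x
    constructor
    · rintro ⟨y, hy, rfl⟩
      rw [LinearMap.mem_ker, Submodule.subtype_apply, ← coe_aeval_restrict
        (primaryComponent_invariant T f), LinearMap.mem_ker.1 hy, ZeroMemClass.coe_zero]
    · intro hx
      refine ⟨⟨x, 1, by rwa [pow_one]⟩, ?_, rfl⟩
      refine LinearMap.mem_ker.2 (Subtype.ext ?_)
      rw [coe_aeval_restrict]
      exact hx
  rw [← hmap, ((LinearMap.ker (aeval (T.restrict (primaryComponent_invariant T f))
    f)).equivMapOfInjective _ (Submodule.subtype_injective _)).finrank_eq]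

end PrimaryComponent

/-! ### Roots in `K` of irreducibles of degree `[K : F]`. -/

section Roots

variable {F K : Type*} [Field F] [Field K] [Algebra F K]

open Classical in
/-- The roots in `K` of a polynomial over `F`. -/
def rootFinset {F : Type*} (K : Type*) [Field F] [Field K] [Algebra F K] (f : F[X]) : Finset K :=
  (f.aroots K).toFinset

theorem mem_rootFinset {f : F[X]} (hf : f ≠ 0) {a : K} :
    a ∈ rootFinset K f ↔ aeval a f = 0 := by
  simp [rootFinset, hf]

theorem disjoint_rootFinset {d : ℕ} {f g : F[X]} (hf : f ∈ Irr F d) (hg : g ∈ Irr F d)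
    (hfg : f ≠ g) : Disjoint (rootFinset K f) (rootFinset K g) := by
  rw [Finset.disjoint_left]
  intro a ha ha'
  rw [mem_rootFinset hf.2.1.ne_zero] at ha
  rw [mem_rootFinset hg.2.1.ne_zero] at ha'
  exact hfg ((minpoly.eq_of_irreducible_of_monic hf.2.1 ha hf.1).trans
    (minpoly.eq_of_irreducible_of_monic hg.2.1 ha' hg.1).symm)

variable [Finite F] [FiniteDimensional F K]

/-- `AdjoinRoot f` has the same degree over `F` as `K`, hence embeds in it; this gives one root, and
normality of `K / F` gives the others. -/
theorem splits_map_of_mem_Irr {f : F[X]} (hf : f ∈ Irr F (finrank F K)) :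
    (f.map (algebraMap F K)).Splits := by
  obtain ⟨hm, hi, hd⟩ := hf
  have : Finite K := Module.finite_of_finite F
  have : Fact (Irreducible f) := ⟨hi⟩
  have hfin : finrank F (AdjoinRoot f) = finrank F K := by
    rw [(AdjoinRoot.powerBasis hi.ne_zero).finrank, AdjoinRoot.powerBasis_dim, hd]
  obtain ⟨φ⟩ := FiniteField.nonempty_algHom_of_finrank_dvd (F := F) (K := AdjoinRoot f) (L := K)
    hfin.dvd
  have hroot : aeval (φ (AdjoinRoot.root f)) f = 0 := by
    rw [aeval_algHom_apply, AdjoinRoot.aeval_eq, AdjoinRoot.mk_self, map_zero]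
  rw [minpoly.eq_of_irreducible_of_monic hi hroot hm]
  exact Normal.splits inferInstance _

theorem card_rootFinset {f : F[X]} (hf : f ∈ Irr F (finrank F K)) :
    (rootFinset K f).card = finrank F K := by
  classical
  have h := card_rootSet_eq_natDegree (PerfectField.separable_of_irreducible hf.2.1)
    (splits_map_of_mem_Irr hf)
  rw [hf.2.2] at h
  rw [← h, ← Nat.card_eq_fintype_card, rootSet_def, Nat.card_coe_set_eq, Set.ncard_coe_finset,
    rootFinset]

theorem map_eq_prod_rootFinset {f : F[X]} (hf : f ∈ Irr F (finrank F K)) :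
    f.map (algebraMap F K) = ∏ a ∈ rootFinset K f, (X - C a) := by
  classical
  have hnodup : (f.aroots K).Nodup :=
    nodup_roots ((PerfectField.separable_of_irreducible hf.2.1).map)
  have h := (splits_map_of_mem_Irr hf).eq_prod_roots_of_monic (hf.1.map _)
  rw [h, rootFinset, Finset.prod, Multiset.toFinset_val, Multiset.dedup_eq_self.2 hnodup, aroots]

end Roots

/-! ### Passing from `F`-dimensions to eigenspaces over `K`. -/

section Restriction

variable {F K V : Type*} [Field F] [Field K] [Algebra F K] [AddCommGroup V] [Module K V]

theorem finrank_ker_aeval_prod [FiniteDimensional K V] (T : End K V) (R : Finset K) :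
    finrank K (LinearMap.ker (aeval T (∏ a ∈ R, (X - C a)))) = ∑ a ∈ R, eigDim T a := by
  classical
  induction R using Finset.induction_on with
  | empty =>
    rw [Finset.prod_empty, map_one, Finset.sum_empty,
      show LinearMap.ker (1 : End K V) = ⊥ from LinearMap.ker_id, finrank_bot]
  | insert a R ha ih =>
    have hcop : IsCoprime (X - C a) (∏ c ∈ R, (X - C c)) :=
      IsCoprime.prod_right fun c hc =>
        isCoprime_X_sub_C_of_isUnit_sub (sub_ne_zero.2 (by rintro rfl; exact ha hc)).isUnit
    have h1 : LinearMap.ker (aeval T (X - C a)) = T.eigenspace a := by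
      ext x
      simp [sub_eq_zero]
    rw [Finset.prod_insert ha, Finset.sum_insert ha, ← ih,
      ← sup_ker_aeval_eq_ker_aeval_mul_of_coprime T hcop, eigDim, ← h1,
      ← Submodule.finrank_sup_add_finrank_inf_eq,
      (disjoint_ker_aeval_of_isCoprime T hcop).eq_bot, finrank_bot, add_zero]

variable [Module F V] [IsScalarTower F K V]

theorem aeval_restrictScalars_apply (T : End K V) (f : F[X]) (v : V) :
    aeval (T.restrictScalars F : End F V) f v = aeval T (f.map (algebraMap F K)) v := by
  induction f using Polynomial.induction_on' with
  | add p r hp hr => simp [hp, hr, Polynomial.map_add]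
  | monomial n a =>
    have h : ∀ n, ((T.restrictScalars F : End F V) ^ n) v = (T ^ n) v := by
      intro n
      induction n with
      | zero => rfl
      | succ n ih => rw [pow_succ', pow_succ', End.mul_apply, End.mul_apply, ih]; rfl
    rw [map_monomial, aeval_monomial, aeval_monomial]
    simp [h]

theorem finrank_ker_aeval_restrictScalars (T : End K V) (f : F[X]) :
    finrank F (LinearMap.ker (aeval (T.restrictScalars F : End F V) f)) =
      finrank F K * finrank K (LinearMap.ker (aeval T (f.map (algebraMap F K)))) := by
  rw [finrank_mul_finrank]
  have h : LinearMap.ker (aeval (T.restrictScalars F : End F V) f) =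
      (LinearMap.ker (aeval T (f.map (algebraMap F K)))).restrictScalars F := by
    ext v
    exact Eq.congr_left (aeval_restrictScalars_apply T f v)
  rw [h]
  rfl

end Restriction

theorem isPrimaryCyclic_overF_iff {F K : Type*} [Field F] [Finite F] [Field K] [Algebra F K]
    [FiniteDimensional F K] {c : ℕ} (M : Matrix (Fin c) (Fin c) K) {f : F[X]}
    (hf : f ∈ Irr F (finrank F K)) :
    IsPrimaryCyclic (overF F M) f ↔ ∑ a ∈ rootFinset K f, eigDim M.vecMulLinear a = 1 := by
  rw [isPrimaryCyclic_iff hf.2.1 hf.1, overF, finrank_ker_aeval_restrictScalars,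
    map_eq_prod_rootFinset hf, finrank_ker_aeval_prod, hf.2.2]
  -- `deg f = [K : F]`, so what remains is `b * Σ = b`.
  exact mul_eq_left₀ finrank_pos.ne'

/-! ### Convergence and nonvanishing of `P`. -/

section EulerSeries

theorem omegaN_succ (n : ℕ) (u : ℂ) (Q : ℕ) :
    omegaN (n + 1) u Q = omegaN n u Q * (1 - u * ((Q : ℂ) ^ (n + 1))⁻¹) := by
  rw [omegaN, omegaN, Finset.prod_Icc_succ_top (by omega)]

theorem one_sub_inv_pow_ne_zero {Q : ℕ} (hQ : 2 ≤ Q) (n : ℕ) :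
    (1 : ℂ) - ((Q : ℂ) ^ (n + 1))⁻¹ ≠ 0 := by
  have h : ((Q : ℂ) ^ (n + 1)) ≠ 1 := by
    have : Q ^ (n + 1) ≠ 1 := (Nat.one_lt_pow (by omega) (by omega)).ne'
    exact_mod_cast this
  intro h0
  exact h (inv_eq_one.1 (sub_eq_zero.1 h0).symm)

theorem omegaN_one_ne_zero {Q : ℕ} (hQ : 2 ≤ Q) (n : ℕ) : omegaN n 1 Q ≠ 0 := by
  induction n with
  | zero => simp [omegaN]
  | succ n ih =>
    rw [omegaN_succ, one_mul]
    exact mul_ne_zero ih (one_sub_inv_pow_ne_zero hQ n)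

theorem PTerm_zero (u : ℂ) (Q : ℕ) : PTerm u Q 0 = 1 := by simp [PTerm, omegaN]

theorem PTerm_succ_mul {Q : ℕ} (hQ : 2 ≤ Q) (u : ℂ) (n : ℕ) :
    PTerm u Q (n + 1) * (1 - ((Q : ℂ) ^ (n + 1))⁻¹) = u * PTerm u Q n := by
  have h1 := omegaN_one_ne_zero hQ n
  have h2 := one_sub_inv_pow_ne_zero hQ n
  rw [PTerm, PTerm, omegaN_succ, one_mul, pow_succ]
  rw [div_mul_eq_mul_div, mul_div_mul_right _ _ h2]
  ring

theorem summable_norm_PTerm {Q : ℕ} (hQ : 2 ≤ Q) {u : ℂ} (hu : ‖u‖ < 1) :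
    Summable fun n => ‖PTerm u Q n‖ := by
  -- Ratio test: the ratios `‖u‖ / ‖1 - Q^{-(n+1)}‖` tend to `‖u‖`, so any `r` strictly between
  -- `‖u‖` and 1 eventually bounds them.
  obtain ⟨r, hur, hr⟩ := exists_between hu
  have hr0 : 0 < r := (norm_nonneg u).trans_lt hur
  have hlim : Tendsto (fun n : ℕ => r * ‖(1 : ℂ) - ((Q : ℂ) ^ (n + 1))⁻¹‖) atTop (𝓝 r) := by
    have h1 : Tendsto (fun n : ℕ => ((Q : ℂ)⁻¹) ^ (n + 1)) atTop (𝓝 0) := by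
      refine (tendsto_pow_atTop_nhds_zero_of_norm_lt_one ?_).comp (tendsto_add_atTop_nat 1)
      rw [norm_inv, Complex.norm_natCast]
      exact inv_lt_one_of_one_lt₀ (by exact_mod_cast (by omega : 1 < Q))
    have h2 := ((tendsto_const_nhds (x := (1 : ℂ))).sub h1).norm.const_mul r
    simpa [inv_pow] using h2
  refine (summable_of_ratio_norm_eventually_le (f := fun n => PTerm u Q n) hr ?_).norm
  filter_upwards [hlim.eventually_const_le hur] with n hn
  have h := congrArg norm (PTerm_succ_mul hQ u n)
  rw [norm_mul, norm_mul] at h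
  have hpos : 0 < ‖(1 : ℂ) - ((Q : ℂ) ^ (n + 1))⁻¹‖ :=
    norm_pos_iff.2 (one_sub_inv_pow_ne_zero hQ n)
  refine le_of_mul_le_mul_right ?_ hpos
  rw [h, mul_right_comm]
  exact mul_le_mul_of_nonneg_right hn (norm_nonneg _)

theorem summable_PTerm {Q : ℕ} (hQ : 2 ≤ Q) {u : ℂ} (hu : ‖u‖ < 1) :
    Summable fun n => PTerm u Q n := (summable_norm_PTerm hQ hu).of_norm

theorem P_eq_tsum {Q : ℕ} (hQ : 2 ≤ Q) {u : ℂ} (hu : ‖u‖ < 1) :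
    P u Q = ∑' n, PTerm u Q n := by
  rw [(summable_PTerm hQ hu).tsum_eq_zero_add, PTerm_zero, P]

theorem norm_div_pow_le {Q : ℕ} (hQ : 2 ≤ Q) (u : ℂ) (k : ℕ) : ‖u / (Q : ℂ) ^ k‖ ≤ ‖u‖ := by
  rw [norm_div, norm_pow, Complex.norm_natCast]
  refine div_le_self (norm_nonneg u) (one_le_pow₀ ?_)
  exact_mod_cast (by omega : 1 ≤ Q)

/-- The functional equation `P(u / Q) = (1 - u) P(u)`. -/
theorem P_div {Q : ℕ} (hQ : 2 ≤ Q) {u : ℂ} (hu : ‖u‖ < 1) :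
    P (u / Q) Q = (1 - u) * P u Q := by
  have hQ0 : (Q : ℂ) ≠ 0 := by exact_mod_cast (by omega : Q ≠ 0)
  have hu' : ‖u / (Q : ℂ)‖ < 1 := by
    simpa using (norm_div_pow_le hQ u 1).trans_lt hu
  have hs := summable_PTerm hQ hu
  have hs' := summable_PTerm hQ hu'
  have key : ∀ n, PTerm (u / Q) Q (n + 1) = PTerm u Q (n + 1) - u * PTerm u Q n := by
    intro n
    rw [← PTerm_succ_mul hQ, PTerm, PTerm, div_pow]
    ring
  have h1 : ∑' n, PTerm (u / Q) Q (n + 1) = ∑' n, PTerm u Q (n + 1) - u * ∑' n, PTerm u Q n := by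
    rw [tsum_congr key, Summable.tsum_sub ((summable_nat_add_iff 1).2 hs) (hs.mul_left u),
      tsum_mul_left]
  rw [← P_eq_tsum hQ hu] at h1
  rw [P, h1]
  conv_rhs => rw [sub_mul, one_mul]
  nth_rewrite 2 [P]
  ring

/-- By the functional equation a zero at `u` propagates to every `u / Q ^ k`. These tend to 0, where
`P` is continuous with value 1. -/
theorem P_ne_zero {Q : ℕ} (hQ : 2 ≤ Q) {u : ℂ} (hu : ‖u‖ < 1) : P u Q ≠ 0 := by
  intro h0
  have hlt : ∀ k, ‖u / (Q : ℂ) ^ k‖ < 1 := fun k => (norm_div_pow_le hQ u k).trans_lt hu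
  have hk : ∀ k, P (u / (Q : ℂ) ^ k) Q = 0 := by
    intro k
    induction k with
    | zero => simpa using h0
    | succ k ih =>
      have := P_div hQ (hlt k)
      rwa [ih, mul_zero, div_div, ← pow_succ] at this
  have hu0 : Tendsto (fun k : ℕ => u / (Q : ℂ) ^ k) atTop (𝓝 0) := by
    have h1 : Tendsto (fun n : ℕ => ((Q : ℂ)⁻¹) ^ n) atTop (𝓝 0) := by
      refine tendsto_pow_atTop_nhds_zero_of_norm_lt_one ?_
      rw [norm_inv, Complex.norm_natCast]
      exact inv_lt_one_of_one_lt₀ (by exact_mod_cast (by omega : 1 < Q))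
    simpa [inv_pow, div_eq_mul_inv] using h1.const_mul u
  have hlim : Tendsto (fun k : ℕ => ∑' n, PTerm (u / (Q : ℂ) ^ k) Q n) atTop
      (𝓝 (∑' n, PTerm 0 Q n)) := by
    refine tendsto_tsum_of_dominated_convergence (summable_norm_PTerm hQ hu) (fun n => ?_)
      (Eventually.of_forall fun k n => ?_)
    · exact (hu0.pow n).div_const _
    · rw [PTerm, PTerm, norm_div, norm_div, norm_pow, norm_pow]
      exact div_le_div_of_nonneg_right
        (pow_le_pow_left₀ (norm_nonneg _) (norm_div_pow_le hQ u k) n) (norm_nonneg _)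
  have h00 : (∑' n, PTerm 0 Q n) = 1 := by
    rw [tsum_eq_single 0 fun n hn => by simp [PTerm, hn], PTerm_zero]
  have hconst : ∀ k : ℕ, ∑' n, PTerm (u / (Q : ℂ) ^ k) Q n = 0 := fun k => by
    rw [← P_eq_tsum hQ (hlt k), hk]
  simp only [hconst, h00] at hlim
  exact zero_ne_one (tendsto_nhds_unique tendsto_const_nhds hlim)

end EulerSeries

/-! ### Generating functions and their factorization at one eigenvalue. -/

section Weights

variable {K : Type*} [Field K]

/-- The proportion `|{T : p T}| / |GL(n, K)|`, for endomorphisms `T` of `K ^ n`. -/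
def weight {K : Type*} [Field K] (p : ∀ n : ℕ, End K (Fin n → K) → Prop) (n : ℕ) : ℂ :=
  (Nat.card {T // p n T} : ℂ) / (Nat.card (Matrix.GeneralLinearGroup (Fin n) K) : ℂ)

/-- The generating function of the weights of a family of endomorphisms. -/
def genFun {K : Type*} [Field K] (p : ∀ n : ℕ, End K (Fin n → K) → Prop) (u : ℂ) : ℂ :=
  ∑' n, weight p n * u ^ n

/-- The endomorphisms whose geometric multiplicities satisfy `Φ`. -/
def multFamily {K : Type*} [Field K] (Φ : (K → ℕ) → Prop) (n : ℕ) (T : End K (Fin n → K)) : Prop :=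
  Φ (eigDim T)

/-- The nilpotent endomorphisms whose kernel has a dimension satisfying `Ψ`. -/
def nilFamily (K : Type*) [Field K] (Ψ : ℕ → Prop) (n : ℕ) (T : End K (Fin n → K)) : Prop :=
  IsNilpotent T ∧ Ψ (eigDim T 0)

theorem card_GL_eq_card_linearEquiv (n : ℕ) :
    Nat.card (Matrix.GeneralLinearGroup (Fin n) K) = Nat.card ((Fin n → K) ≃ₗ[K] (Fin n → K)) :=
  Nat.card_congr (Matrix.GeneralLinearGroup.toLin.trans
    (LinearMap.GeneralLinearGroup.generalLinearEquiv K (Fin n → K))).toEquiv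

theorem card_nilpotent_sub {V : Type*} [AddCommGroup V] [Module K V] (a : K) (Ψ : ℕ → Prop) :
    Nat.card {Y : End K V // IsNilpotent (Y - algebraMap K (End K V) a) ∧ Ψ (eigDim Y a)} =
      Nat.card {Y : End K V // IsNilpotent Y ∧ Ψ (eigDim Y 0)} := by
  refine Nat.card_congr ((Equiv.subRight (algebraMap K (End K V) a)).subtypeEquiv fun Y => ?_)
  have h : eigDim (Y - algebraMap K (End K V) a) 0 = eigDim Y a := by
    unfold eigDim
    suffices (Y - algebraMap K (End K V) a).eigenspace 0 = Y.eigenspace a by rw [this]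
    ext x
    simp [sub_eq_zero]
  rw [Equiv.subRight_apply, h]

theorem weight_regular_nilpotent_zero : weight (nilFamily K fun d => d = 1) 0 = 0 := by
  have h : IsEmpty {T : End K (Fin 0 → K) // nilFamily K (fun d => d = 1) 0 T} := by
    refine ⟨fun T => ?_⟩
    have h1 := T.2.2
    rw [eigDim_zero_right, finrank_zero_of_subsingleton] at h1
    exact zero_ne_one h1
  rw [weight, Nat.card_of_isEmpty, Nat.cast_zero, zero_div]

variable [Finite K]

theorem card_GL_ne_zero (n : ℕ) :
    (Nat.card (Matrix.GeneralLinearGroup (Fin n) K) : ℂ) ≠ 0 := by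
  exact_mod_cast Nat.card_pos.ne'

theorem card_GL_eq_pow_mul_omegaN (n : ℕ) :
    (Nat.card (Matrix.GeneralLinearGroup (Fin n) K) : ℂ) =
      (Nat.card K : ℂ) ^ (n * n) * omegaN n 1 (Nat.card K) := by
  have := Fintype.ofFinite K
  have hQ : 2 ≤ Nat.card K := Finite.one_lt_card
  set Q := Nat.card K with hQdef
  have hQ0 : (Q : ℂ) ≠ 0 := by exact_mod_cast (by omega : Q ≠ 0)
  have h1 : omegaN n 1 Q = ∏ i ∈ Finset.range n, (1 - ((Q : ℂ) ^ (i + 1))⁻¹) := by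
    induction n with
    | zero => simp [omegaN]
    | succ n ih => rw [omegaN_succ, ih, Finset.prod_range_succ, one_mul]
  have hpow : ((Q : ℂ) ^ n) ^ n = ∏ _i ∈ Finset.range n, (Q : ℂ) ^ n := by simp
  -- After reversing the product, the factors match as `Q^n - Q^(n-1-i) = Q^n (1 - Q^{-(i+1)})`.
  rw [Matrix.card_GL_field, ← Nat.card_eq_fintype_card, ← hQdef,
    Fin.prod_univ_eq_prod_range (fun i => Q ^ n - Q ^ i) n, ← Finset.prod_range_reflect, h1,
    pow_mul, hpow, ← Finset.prod_mul_distrib, Nat.cast_prod]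
  refine Finset.prod_congr rfl fun i hi => ?_
  have hi' := Finset.mem_range.1 hi
  rw [Nat.cast_sub (Nat.pow_le_pow_right (by omega) (by omega)), mul_sub, mul_one]
  congr 1
  · push_cast
    rfl
  · rw [eq_mul_inv_iff_mul_eq₀ (pow_ne_zero _ hQ0)]
    push_cast
    rw [← pow_add]
    congr 1
    omega

theorem weight_true (n : ℕ) :
    weight (multFamily fun _ : K → ℕ => True) n = (omegaN n 1 (Nat.card K))⁻¹ := by
  have hQ : 2 ≤ Nat.card K := Finite.one_lt_card
  have hQ0 : (Nat.card K : ℂ) ≠ 0 := by exact_mod_cast (by omega : Nat.card K ≠ 0)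
  have h : Nat.card {T : End K (Fin n → K) // multFamily (fun _ => True) n T} =
      Nat.card K ^ (n * n) := by
    rw [Nat.card_congr (Equiv.subtypeUnivEquiv (p := multFamily (fun _ : K → ℕ => True) n)
        fun _ => trivial),
      Module.natCard_eq_pow_finrank (K := K) (V := End K (Fin n → K)), finrank_linearMap]
    simp
  rw [weight, h, card_GL_eq_pow_mul_omegaN, Nat.cast_pow,
    div_mul_cancel_left₀ (pow_ne_zero _ hQ0)]

/-- Comparison with the family of all endomorphisms, which makes every generating function used here
converge absolutely. -/
theorem norm_weight_mul_le (p : ∀ n : ℕ, End K (Fin n → K) → Prop) (u : ℂ) (n : ℕ) :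
    ‖weight p n * u ^ n‖ ≤ ‖PTerm u (Nat.card K) n‖ := by
  have : Finite (End K (Fin n → K)) := Module.finite_of_finite K
  have h : PTerm u (Nat.card K) n = weight (multFamily fun _ : K → ℕ => True) n * u ^ n := by
    rw [weight_true, PTerm, div_eq_inv_mul]
  rw [h, norm_mul, norm_mul]
  refine mul_le_mul_of_nonneg_right ?_ (norm_nonneg _)
  rw [weight, weight, norm_div, norm_div, Complex.norm_natCast, Complex.norm_natCast]
  refine div_le_div_of_nonneg_right ?_ (Nat.cast_nonneg _)
  exact_mod_cast Nat.card_le_card_of_injective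
    (Subtype.map (q := multFamily (fun _ : K → ℕ => True) n) id fun _ _ => trivial)
    (Subtype.map_injective _ Function.injective_id)

theorem summable_norm_weight (p : ∀ n : ℕ, End K (Fin n → K) → Prop) {u : ℂ} (hu : ‖u‖ < 1) :
    Summable fun n => ‖weight p n * u ^ n‖ :=
  Summable.of_nonneg_of_le (fun _ => norm_nonneg _) (norm_weight_mul_le p u)
    (summable_norm_PTerm Finite.one_lt_card hu)

theorem summable_weight (p : ∀ n : ℕ, End K (Fin n → K) → Prop) {u : ℂ} (hu : ‖u‖ < 1) :
    Summable fun n => weight p n * u ^ n := (summable_norm_weight p hu).of_norm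

theorem genFun_true {u : ℂ} (hu : ‖u‖ < 1) :
    genFun (multFamily fun _ : K → ℕ => True) u = P u (Nat.card K) := by
  rw [P_eq_tsum Finite.one_lt_card hu, genFun]
  exact tsum_congr fun n => by rw [weight_true, PTerm, div_eq_inv_mul]

/-- Endomorphisms are sorted by the algebraic multiplicity of `a`. Dividing
`card_rootMultiplicity_eq_mul` by the three orders of `GL` turns each class into a product of
weights; subtracting `a` makes the local factor nilpotent and independent of `a`. -/
theorem weight_and_eq_sum {a : K} {Φ : (K → ℕ) → Prop} (hΦ : IndepOf {a} Φ) (Ψ : ℕ → Prop)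
    (n : ℕ) :
    weight (multFamily fun k => Φ k ∧ Ψ (k a)) n =
      ∑ km ∈ Finset.HasAntidiagonal.antidiagonal n, weight (nilFamily K Ψ) km.1 *
        weight (multFamily fun k => Φ k ∧ k a = 0) km.2 := by
  classical
  have : Finite (End K (Fin n → K)) := Module.finite_of_finite K
  have := Fintype.ofFinite (End K (Fin n → K))
  have hle : ∀ T : End K (Fin n → K), T.charpoly.rootMultiplicity a ≤ n := by
    intro T
    have h1 := Polynomial.rootMultiplicity_le_rootMultiplicity_of_dvd
      T.charpoly_monic.ne_zero dvd_rfl a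
    have h2 := LinearMap.finrank_maxGenEigenspace_eq T a
    have h3 := Submodule.finrank_le (T.maxGenEigenspace a)
    rw [h2, finrank_fin_fun] at h3
    exact h3
  have hsum : Nat.card {T : End K (Fin n → K) // Φ (eigDim T) ∧ Ψ (eigDim T a)} =
      ∑ km ∈ Finset.HasAntidiagonal.antidiagonal n, Nat.card {T : End K (Fin n → K) //
        (Φ (eigDim T) ∧ Ψ (eigDim T a)) ∧ T.charpoly.rootMultiplicity a = km.1} := by
    rw [Nat.card_eq_fintype_card, Fintype.card_subtype,
      Finset.card_eq_sum_card_fiberwise (t := Finset.HasAntidiagonal.antidiagonal n)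
        (f := fun T => (T.charpoly.rootMultiplicity a, n - T.charpoly.rootMultiplicity a))]
    · refine Finset.sum_congr rfl fun km hkm => ?_
      rw [Nat.card_eq_fintype_card, Fintype.card_subtype, Finset.filter_filter]
      congr 1
      refine Finset.filter_congr fun T _ => and_congr_right fun _ => ?_
      rw [Finset.HasAntidiagonal.mem_antidiagonal] at hkm
      rw [Prod.ext_iff]
      dsimp only
      omega
    · intro T _
      simpa using Nat.add_sub_cancel' (hle T)
  rw [weight]
  simp only [multFamily]
  rw [hsum, Nat.cast_sum, Finset.sum_div]
  refine Finset.sum_congr rfl fun km hkm => ?_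
  rw [Finset.HasAntidiagonal.mem_antidiagonal] at hkm
  have h := card_rootMultiplicity_eq_mul (U := Fin km.1 → K) (W := Fin km.2 → K)
    (V := Fin n → K) (by simp [hkm]) a hΦ Ψ
  rw [card_nilpotent_sub, finrank_fin_fun, ← card_GL_eq_card_linearEquiv,
    ← card_GL_eq_card_linearEquiv, ← card_GL_eq_card_linearEquiv] at h
  have h' := congrArg (Nat.cast (R := ℂ)) h
  simp only [Nat.cast_mul] at h'
  rw [weight, weight]
  simp only [multFamily, nilFamily]
  rw [div_mul_div_comm, div_eq_div_iff (card_GL_ne_zero n)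
    (mul_ne_zero (card_GL_ne_zero _) (card_GL_ne_zero _)), h', mul_comm]

theorem genFun_and_eq_mul {a : K} {Φ : (K → ℕ) → Prop} (hΦ : IndepOf {a} Φ) (Ψ : ℕ → Prop)
    {u : ℂ} (hu : ‖u‖ < 1) :
    genFun (multFamily fun k => Φ k ∧ Ψ (k a)) u =
      genFun (nilFamily K Ψ) u * genFun (multFamily fun k => Φ k ∧ k a = 0) u := by
  rw [genFun, genFun, genFun, tsum_mul_tsum_eq_tsum_sum_antidiagonal_of_summable_norm
    (summable_norm_weight _ hu) (summable_norm_weight _ hu)]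
  refine tsum_congr fun n => ?_
  rw [weight_and_eq_sum hΦ, Finset.sum_mul]
  refine Finset.sum_congr rfl fun km hkm => ?_
  rw [← Finset.HasAntidiagonal.mem_antidiagonal.1 hkm, pow_add]
  ring

theorem weight_isUnit (n : ℕ) :
    weight (multFamily fun k : K → ℕ => True ∧ k 0 = 0) n = 1 := by
  rw [weight, div_eq_one_iff_eq (card_GL_ne_zero n), card_GL_eq_card_linearEquiv]
  congr 1
  refine Nat.card_congr (Equiv.ofBijective (fun e : (Fin n → K) ≃ₗ[K] (Fin n → K) =>
    (⟨e.toLinearMap, trivial, ?_⟩ :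
      {T : End K (Fin n → K) // multFamily (fun k : K → ℕ => True ∧ k 0 = 0) n T}))
    ⟨?_, ?_⟩).symm
  · rw [eigDim_zero_right, LinearEquiv.ker, finrank_bot]
  · intro e e' h
    exact LinearEquiv.toLinearMap_injective (congrArg Subtype.val h)
  · rintro ⟨T, -, hT⟩
    rw [eigDim_zero_right, Submodule.finrank_eq_zero, LinearMap.ker_eq_bot] at hT
    exact ⟨LinearEquiv.ofInjectiveEndo T hT, Subtype.ext (LinearMap.ext fun _ => rfl)⟩

/-- The generating function of nilpotent endomorphisms. -/
theorem genFun_nilpotent {u : ℂ} (hu : ‖u‖ < 1) :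
    genFun (nilFamily K fun _ => True) u = (1 - u) * P u (Nat.card K) := by
  -- With trivial conditions at `a = 0` the factorization reads: all = nilpotent × invertible, i.e.
  -- `P` = nilpotent × `1 / (1 - u)`.
  have h := genFun_and_eq_mul (K := K) (a := 0) (Φ := fun _ => True) (fun _ _ _ => Iff.rfl)
    (fun _ => True) hu
  simp only [and_self] at h
  have h1 : (1 : ℂ) - u ≠ 0 := sub_ne_zero.2 fun h => by simp [← h] at hu
  have h2 : genFun (multFamily fun k : K → ℕ => True ∧ k 0 = 0) u = (1 - u)⁻¹ := by
    rw [genFun, ← tsum_geometric_of_norm_lt_one hu]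
    exact tsum_congr fun n => by rw [weight_isUnit, one_mul]
  rw [h2, genFun_true hu] at h
  rw [h]
  field_simp

theorem weight_regular_nilpotent_succ (k : ℕ) (u : ℂ) :
    weight (nilFamily K fun d => d = 1) (k + 1) * u ^ (k + 1) =
      STerm u (Nat.card K) (k + 1) := by
  have := Fintype.ofFinite K
  have hQ : 2 ≤ Nat.card K := Finite.one_lt_card
  have hQ0 : (Nat.card K : ℂ) ≠ 0 := by exact_mod_cast (by omega : Nat.card K ≠ 0)
  have h := card_regular_nilpotent_mul (K := K) (V := Fin (k + 1) → K) (k := k) (by simp)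
  rw [← Nat.card_congr (Matrix.equiv_GL_linearindependent (𝔽 := K) (k + 1))] at h
  have h' := congrArg (Nat.cast (R := ℂ)) h
  rw [Nat.cast_mul, Nat.cast_sub (Nat.pow_le_pow_right (by omega) (by omega)), Nat.cast_pow,
    Nat.cast_pow] at h'
  have h1 : (Nat.card K : ℂ) ^ (k + 1) * (1 - (Nat.card K : ℂ)⁻¹) =
      (Nat.card K : ℂ) ^ (k + 1) - (Nat.card K : ℂ) ^ k := by
    rw [mul_sub, mul_one, pow_succ, mul_assoc, mul_inv_cancel₀ hQ0, mul_one]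
  rw [← h1] at h'
  have h2 := card_GL_ne_zero (K := K) (k + 1)
  rw [weight, STerm]
  simp only [nilFamily]
  rw [← h'] at h2 ⊢
  rw [div_mul_cancel_left₀ (left_ne_zero_of_mul h2), div_eq_inv_mul]

/-- The generating function of nilpotent endomorphisms with one-dimensional kernel. -/
theorem hasSum_STerm {u : ℂ} (hu : ‖u‖ < 1) :
    HasSum (fun n => STerm u (Nat.card K) (n + 1)) (genFun (nilFamily K fun d => d = 1) u) := by
  have h := (summable_weight (nilFamily K fun d => d = 1) hu).hasSum
  have h1 := (hasSum_nat_add_iff' 1).2 h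
  simp only [weight_regular_nilpotent_succ, Finset.sum_range_one, weight_regular_nilpotent_zero,
    zero_mul, sub_zero] at h1
  exact h1

theorem genFun_regular_nilpotent {u : ℂ} (hu : ‖u‖ < 1) :
    genFun (nilFamily K fun d => d = 1) u = S u (Nat.card K) :=
  (hasSum_STerm hu).tsum_eq.symm

end Weights

/-! ### Conditions on several eigenvalues. -/

section LocalConditions

variable {K : Type*}

theorem IndepOf.mono {R R' : Set K} (h : R' ⊆ R) {Φ : (K → ℕ) → Prop} (hΦ : IndepOf R Φ) :
    IndepOf R' Φ :=
  fun k l hkl => hΦ k l fun c hc => hkl c fun h' => hc (h h')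

theorem IndepOf.and {R : Set K} {Φ Θ : (K → ℕ) → Prop} (hΦ : IndepOf R Φ) (hΘ : IndepOf R Θ) :
    IndepOf R fun k => Φ k ∧ Θ k :=
  fun k l hkl => and_congr (hΦ k l hkl) (hΘ k l hkl)

theorem IndepOf.not {R : Set K} {Φ : (K → ℕ) → Prop} (hΦ : IndepOf R Φ) :
    IndepOf R fun k => ¬ Φ k :=
  fun k l hkl => not_congr (hΦ k l hkl)

theorem indepOf_forall {ι : Type*} {R : Set K} {Θ : ι → (K → ℕ) → Prop} {I : Finset ι}
    (hΘ : ∀ i ∈ I, IndepOf R (Θ i)) : IndepOf R fun k => ∀ i ∈ I, Θ i k :=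
  fun k l hkl => forall₂_congr fun i hi => hΘ i hi k l hkl

theorem indepOf_sum_eq {R : Set K} {A : Finset K} (hA : Disjoint R A) (d : ℕ) :
    IndepOf R fun k => ∑ a ∈ A, k a = d := fun k l hkl => by
  dsimp only
  rw [Finset.sum_congr rfl fun a ha => hkl a fun haR => Set.disjoint_left.1 hA haR ha]

variable [Field K] {u : ℂ}

theorem genFun_congr {p p' : (K → ℕ) → Prop} (h : ∀ k, p k ↔ p' k) :
    genFun (multFamily p) u = genFun (multFamily p') u := by
  rw [show p = p' from funext fun k => propext (h k)]

variable [Finite K]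

theorem genFun_and_add_genFun_and_not (p Θ : (K → ℕ) → Prop) (hu : ‖u‖ < 1) :
    genFun (multFamily fun k => p k ∧ Θ k) u + genFun (multFamily fun k => p k ∧ ¬ Θ k) u =
      genFun (multFamily p) u := by
  classical
  rw [genFun, genFun, genFun, ← Summable.tsum_add (summable_weight _ hu) (summable_weight _ hu)]
  refine tsum_congr fun n => ?_
  have : Finite (End K (Fin n → K)) := Module.finite_of_finite K
  have := Fintype.ofFinite (End K (Fin n → K))
  rw [← add_mul, weight, weight, weight, ← add_div, ← Nat.cast_add]
  congr 3
  simp only [multFamily, Nat.card_eq_fintype_card, Fintype.card_subtype]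
  rw [← Finset.filter_filter, ← Finset.filter_filter]
  exact Finset.card_filter_add_card_filter_not _

theorem genFun_eq_mul_genFun_eq_zero {a : K} {Φ : (K → ℕ) → Prop} (hΦ : IndepOf {a} Φ)
    (hu : ‖u‖ < 1) :
    genFun (multFamily Φ) u =
      (1 - u) * P u (Nat.card K) * genFun (multFamily fun k => Φ k ∧ k a = 0) u := by
  have h := genFun_and_eq_mul hΦ (fun _ => True) hu
  simp only [and_true] at h
  rw [h, genFun_nilpotent hu]

theorem genFun_eq_pow_mul_genFun_forall {R : Finset K} {Φ : (K → ℕ) → Prop}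
    (hΦ : IndepOf R Φ) (hu : ‖u‖ < 1) :
    genFun (multFamily Φ) u = ((1 - u) * P u (Nat.card K)) ^ R.card *
      genFun (multFamily fun k => Φ k ∧ ∑ c ∈ R, k c = 0) u := by
  classical
  induction R using Finset.induction_on with
  | empty => simp
  | insert a R ha ih =>
    have hind : IndepOf {a} fun k => Φ k ∧ ∑ c ∈ R, k c = 0 :=
      (hΦ.mono (by simp)).and (indepOf_sum_eq (by simpa using ha) 0)
    have h1 := genFun_eq_mul_genFun_eq_zero hind hu
    have h2 : genFun (multFamily fun k : K → ℕ => (Φ k ∧ ∑ c ∈ R, k c = 0) ∧ k a = 0) u =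
        genFun (multFamily fun k => Φ k ∧ ∑ c ∈ insert a R, k c = 0) u := by
      refine genFun_congr fun k => ?_
      rw [Finset.sum_insert ha, and_assoc]
      exact and_congr_right fun _ => by omega
    rw [ih (hΦ.mono (by simp)), h1, h2, Finset.card_insert_of_notMem ha]
    ring

/-- Imposing that exactly one of the eigenvalues in `R` occurs, with a one-dimensional
eigenspace. -/
theorem pow_mul_genFun_sum_eq_one {R : Finset K} {Φ : (K → ℕ) → Prop}
    (hΦ : IndepOf R Φ) (hu : ‖u‖ < 1) :
    ((1 - u) * P u (Nat.card K)) ^ R.card *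
        genFun (multFamily fun k => Φ k ∧ ∑ c ∈ R, k c = 1) u =
      R.card * S u (Nat.card K) * genFun (multFamily Φ) u := by
  classical
  induction R using Finset.induction_on with
  | empty =>
    -- An empty sum is never 1. The impossible condition has generating function `G` with `G + G =
    -- G`, hence `G = 0`.
    have := genFun_and_add_genFun_and_not (fun k : K → ℕ => Φ k ∧ False) (fun _ => True) hu
    simp only [and_true, not_true, and_false] at this
    simpa using this
  | insert a R ha ih =>
    have hΦR : IndepOf (R : Set K) Φ := hΦ.mono (by simp)
    have hΦa : IndepOf {a} Φ := hΦ.mono (by simp)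
    have hd : Disjoint ({a} : Set K) (R : Set K) := by simpa using ha
    have hind := fun d => hΦa.and (indepOf_sum_eq hd d)
    -- Either `a` is not an eigenvalue and the sum 1 comes from `R`, or `a` has a one-dimensional
    -- eigenspace and nothing in `R` is an eigenvalue. The second case adds one more `S`.
    have hsplit := genFun_and_add_genFun_and_not
      (fun k : K → ℕ => Φ k ∧ ∑ c ∈ insert a R, k c = 1) (fun k => k a = 0) hu
    have h0 : genFun (multFamily fun k : K → ℕ =>
        (Φ k ∧ ∑ c ∈ insert a R, k c = 1) ∧ k a = 0) u =
        genFun (multFamily fun k => (Φ k ∧ ∑ c ∈ R, k c = 1) ∧ k a = 0) u := by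
      refine genFun_congr fun k => ?_
      rw [Finset.sum_insert ha, and_assoc, and_assoc]
      exact and_congr_right fun _ => by omega
    have h1 : genFun (multFamily fun k : K → ℕ =>
        (Φ k ∧ ∑ c ∈ insert a R, k c = 1) ∧ ¬ k a = 0) u =
        genFun (multFamily fun k => (Φ k ∧ ∑ c ∈ R, k c = 0) ∧ k a = 1) u := by
      refine genFun_congr fun k => ?_
      rw [Finset.sum_insert ha, and_assoc, and_assoc]
      exact and_congr_right fun _ => by omega
    rw [h0, h1, genFun_and_eq_mul (hind 0) (fun d => d = 1) hu, genFun_regular_nilpotent hu]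
      at hsplit
    have h2 := genFun_eq_mul_genFun_eq_zero (hind 1) hu
    have h3 := genFun_eq_mul_genFun_eq_zero (hind 0) hu
    have h4 := genFun_eq_pow_mul_genFun_forall hΦR hu
    have h5 := ih hΦR
    rw [h2] at h5
    rw [h3] at h4
    rw [← hsplit, Finset.card_insert_of_notMem ha, Nat.cast_add, Nat.cast_one, pow_succ]
    linear_combination h5 - S u (Nat.card K) * h4

theorem genFun_sum_eq_one {R : Finset K} {q b : ℕ} (hq : Nat.card K = q ^ b) (hR : R.card = b)
    {Φ : (K → ℕ) → Prop} (hΦ : IndepOf R Φ) (hu : ‖u‖ < 1) :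
    genFun (multFamily fun k => Φ k ∧ ∑ c ∈ R, k c = 1) u =
      H u q b * genFun (multFamily Φ) u := by
  have h := pow_mul_genFun_sum_eq_one hΦ hu
  have hP : P u (Nat.card K) ≠ 0 := P_ne_zero Finite.one_lt_card hu
  have h1 : (1 : ℂ) - u ≠ 0 := sub_ne_zero.2 fun h => by simp [← h] at hu
  rw [hR, mul_pow] at h
  rw [H, ← hq, zpow_neg, zpow_neg, zpow_natCast, zpow_natCast]
  field_simp
  linear_combination h

variable {ι : Type*} {q b : ℕ} {A : ι → Finset K}

theorem genFun_forall_sum_eq_one (hq : Nat.card K = q ^ b) (I : Finset ι)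
    (hcard : ∀ i ∈ I, (A i).card = b)
    (hdisj : ∀ i ∈ I, ∀ j ∈ I, i ≠ j → Disjoint (A i) (A j)) (hu : ‖u‖ < 1) :
    genFun (multFamily fun k => ∀ i ∈ I, ∑ a ∈ A i, k a = 1) u =
      P u (q ^ b) * H u q b ^ I.card := by
  classical
  induction I using Finset.induction_on with
  | empty => simp [genFun_true hu, hq]
  | insert i I hi ih =>
    rw [Finset.card_insert_of_notMem hi, pow_succ, ← mul_assoc,
      ← ih (fun j hj => hcard j (Finset.mem_insert_of_mem hj)) (fun j hj l hl =>
        hdisj j (Finset.mem_insert_of_mem hj) l (Finset.mem_insert_of_mem hl)), mul_comm _ (H u q b),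
      ← genFun_sum_eq_one hq (hcard i (Finset.mem_insert_self i I)) (indepOf_forall fun j hj =>
        indepOf_sum_eq (Finset.disjoint_coe.2 (hdisj i (Finset.mem_insert_self i I) j
          (Finset.mem_insert_of_mem hj) (by rintro rfl; exact hi hj))) 1) hu]
    exact genFun_congr fun k => by rw [Finset.forall_mem_insert, and_comm]

/-- Adding `i` to `I` subtracts the part where the sum over `A i` is 1, a fraction `H` of the whole
because the root sets are disjoint. -/
theorem genFun_forall_not_sum_eq_one (hq : Nat.card K = q ^ b) (I : Finset ι)
    (hcard : ∀ i ∈ I, (A i).card = b)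
    (hdisj : ∀ i ∈ I, ∀ j ∈ I, i ≠ j → Disjoint (A i) (A j)) (hu : ‖u‖ < 1) :
    genFun (multFamily fun k => ∀ i ∈ I, ¬ ∑ a ∈ A i, k a = 1) u =
      P u (q ^ b) * (1 - H u q b) ^ I.card := by
  classical
  induction I using Finset.induction_on with
  | empty => simp [genFun_true hu, hq]
  | insert i I hi ih =>
    have hind : IndepOf (A i : Set K) fun k => ∀ j ∈ I, ¬ ∑ a ∈ A j, k a = 1 :=
      indepOf_forall fun j hj => (indepOf_sum_eq (Finset.disjoint_coe.2 (hdisj i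
        (Finset.mem_insert_self i I) j (Finset.mem_insert_of_mem hj)
          (by rintro rfl; exact hi hj))) 1).not
    have h1 := genFun_sum_eq_one hq (hcard i (Finset.mem_insert_self i I)) hind hu
    have h2 := genFun_and_add_genFun_and_not (fun k : K → ℕ => ∀ j ∈ I, ¬ ∑ a ∈ A j, k a = 1)
      (fun k => ∑ a ∈ A i, k a = 1) hu
    have h3 := ih (fun j hj => hcard j (Finset.mem_insert_of_mem hj)) (fun j hj l hl =>
        hdisj j (Finset.mem_insert_of_mem hj) l (Finset.mem_insert_of_mem hl))
    have h4 : genFun (multFamily fun k : K → ℕ => ∀ j ∈ insert i I, ¬ ∑ a ∈ A j, k a = 1) u =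
        genFun (multFamily fun k => (∀ j ∈ I, ¬ ∑ a ∈ A j, k a = 1) ∧ ¬ ∑ a ∈ A i, k a = 1) u :=
      genFun_congr fun k => by rw [Finset.forall_mem_insert, and_comm]
    rw [h4, Finset.card_insert_of_notMem hi, pow_succ]
    rw [h1, h3] at h2
    linear_combination h2

end LocalConditions

/-! ### From endomorphisms back to matrices. -/

section MatrixCounts

variable {F K : Type*} [Field F] [Field K] [Algebra F K]

theorem genTerm_eq_weight {A : (c : ℕ) → Set (Matrix (Fin c) (Fin c) K)}
    {p : ∀ n : ℕ, End K (Fin n → K) → Prop} (u : ℂ) (c : ℕ)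
    (h : ∀ M, M ∈ A c ↔ p c M.vecMulLinear) : genTerm A u c = weight p c * u ^ c := by
  rw [genTerm, weight, ← Nat.card_coe_set_eq]
  congr 3
  exact Nat.card_congr ((LinearEquiv.toEquiv Matrix.toLinearMapRight').subtypeEquiv h)

theorem finite_Irr [Finite F] [FiniteDimensional F K] : (Irr F (finrank F K)).Finite := by
  have : Finite K := Module.finite_of_finite F
  refine (Set.finite_range (minpoly F : K → Polynomial F)).subset fun f hf => ?_
  obtain ⟨a, ha⟩ := Finset.card_pos.1 ((card_rootFinset hf).symm ▸ finrank_pos (R := F) (M := K))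
  rw [mem_rootFinset hf.2.1.ne_zero] at ha
  exact ⟨a, (minpoly.eq_of_irreducible_of_monic hf.2.1 ha hf.1).symm⟩

/-- The series for `A` starts at `c = 1` while `genFun` starts at 0. In dimension 0 all
multiplicities vanish, so `¬ Φ 0` removes the extra term. -/
theorem hasSum_genTerm_succ [Finite K] {A : (c : ℕ) → Set (Matrix (Fin c) (Fin c) K)}
    {Φ : (K → ℕ) → Prop} {u : ℂ} (hu : ‖u‖ < 1) (h0 : ¬ Φ 0)
    (h : ∀ c M, M ∈ A c ↔ Φ (eigDim (Matrix.vecMulLinear (m := Fin c) (n := Fin c) M))) :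
    HasSum (fun c => genTerm A u (c + 1)) (genFun (multFamily Φ) u) := by
  have h1 := (hasSum_nat_add_iff' 1).2 (summable_weight (multFamily Φ) hu).hasSum
  have h2 : weight (multFamily Φ) 0 = 0 := by
    have : IsEmpty {T : End K (Fin 0 → K) // multFamily Φ 0 T} := by
      refine ⟨fun T => h0 ?_⟩
      have h3 : eigDim T.1 = 0 := funext fun a => finrank_zero_of_subsingleton
      exact h3 ▸ T.2
    rw [weight, Nat.card_of_isEmpty, Nat.cast_zero, zero_div]
  rw [Finset.sum_range_one, h2, zero_mul, sub_zero] at h1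
  have h4 : ∀ c, genTerm A u c = weight (multFamily Φ) c * u ^ c := fun c =>
    genTerm_eq_weight u c (h c)
  simp only [h4]
  exact h1

end MatrixCounts

end

end PrimaryCyclic

theorem theorem4 {F K : Type*} [Field F] [Finite F] [Field K] [Algebra F K]
    [FiniteDimensional F K] (q b : ℕ) (hq : Nat.card F = q) (hb : Module.finrank F K = b)
    (u : ℂ) (hu : ‖u‖ < 1) :
    -- all the series involved converge, and the negative power of `P` makes sense
    (Summable (fun n : ℕ => PrimaryCyclic.PTerm u (q ^ b) (n + 1)) ∧
      Summable (fun n : ℕ => PrimaryCyclic.STerm u (q ^ b) (n + 1)) ∧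
      PrimaryCyclic.P u (q ^ b) ≠ 0) ∧
    -- the generating function for a fixed nonempty set of irreducibles of degree `b`
    (∀ I : Finset (Polynomial F), I.Nonempty → (I : Set (Polynomial F)) ⊆ PrimaryCyclic.Irr F b →
      Summable (fun c : ℕ => PrimaryCyclic.genTerm (PrimaryCyclic.pcbI F K I) u (c + 1)) ∧
      PrimaryCyclic.PCBI F K I u =
        PrimaryCyclic.P u (q ^ b) * PrimaryCyclic.H u q b ^ I.card) ∧
    -- the generating function for some irreducible of degree `b`
    (Summable (fun c : ℕ => PrimaryCyclic.genTerm (PrimaryCyclic.pcb F K) u (c + 1)) ∧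
      PrimaryCyclic.PCB F K u =
        PrimaryCyclic.P u (q ^ b) *
          (1 - (1 - PrimaryCyclic.H u q b) ^ (PrimaryCyclic.Irr F b).ncard)) := by
  open PrimaryCyclic in
  subst hb
  have : Finite K := Module.finite_of_finite F
  have hK : Nat.card K = q ^ Module.finrank F K := by
    rw [← hq, Module.natCard_eq_pow_finrank (K := F) (V := K)]
  have hdisj : ∀ f ∈ Irr F (Module.finrank F K), ∀ g ∈ Irr F (Module.finrank F K), f ≠ g →
      Disjoint (rootFinset K f) (rootFinset K g) := fun f hf g hg hfg =>
    disjoint_rootFinset hf hg hfg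
  refine ⟨⟨?_, ?_, ?_⟩, fun I hI hIrr => ?_, ?_⟩
  · rw [← hK]
    exact (summable_nat_add_iff 1).2 (summable_PTerm Finite.one_lt_card hu)
  · rw [← hK]
    exact (hasSum_STerm hu).summable
  · rw [← hK]
    exact P_ne_zero Finite.one_lt_card hu
  · have h := hasSum_genTerm_succ (A := pcbI F K I)
      (Φ := fun k => ∀ f ∈ I, ∑ a ∈ rootFinset K f, k a = 1) hu
      -- Nonemptiness of `I` rules out the zero multiplicity function.
      (fun h => by
        obtain ⟨f, hf⟩ := hI
        simpa using h f hf)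
      (fun c M => forall₂_congr fun f hf => isPrimaryCyclic_overF_iff M (hIrr hf))
    rw [genFun_forall_sum_eq_one hK I (fun f hf => card_rootFinset (hIrr hf))
      (fun f hf g hg => hdisj f (hIrr hf) g (hIrr hg)) hu] at h
    exact ⟨h.summable, h.tsum_eq⟩
  · have hfin := finite_Irr (F := F) (K := K)
    have hmem : ∀ {f}, f ∈ hfin.toFinset ↔ f ∈ Irr F (Module.finrank F K) := hfin.mem_toFinset
    have h := hasSum_genTerm_succ (A := pcb F K)
      -- "Some `f`" is phrased as the complement of "no `f`", in the shape produced by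
      -- `genFun_and_add_genFun_and_not`.
      (Φ := fun k => True ∧ ¬ ∀ f ∈ hfin.toFinset, ¬ ∑ a ∈ rootFinset K f, k a = 1) hu
      (by simp)
      (fun c M => by
        push Not
        rw [true_and]
        exact exists_congr fun f => by
          rw [hmem]
          exact and_congr_right fun hf => isPrimaryCyclic_overF_iff M hf)
    have h1 := genFun_and_add_genFun_and_not (fun _ : K → ℕ => True)
      (fun k => ∀ f ∈ hfin.toFinset, ¬ ∑ a ∈ rootFinset K f, k a = 1) hu
    simp only [true_and] at h h1
    rw [genFun_forall_not_sum_eq_one hK _ (fun f hf => card_rootFinset (hmem.1 hf))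
      (fun f hf g hg => hdisj f (hmem.1 hf) g (hmem.1 hg)) hu, genFun_true hu, hK] at h1
    rw [← eq_sub_iff_add_eq'] at h1
    rw [h1] at h
    refine ⟨h.summable, h.tsum_eq.trans ?_⟩
    rw [Set.ncard_eq_toFinset_card _ hfin]
    ring
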